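/- Let $\alpha>0$ and let Gödel's universe be the spacetime with underlying manifold $\mathbb{R}^4$ and metric given, in cylindrical coordinates $(\tau,r,\phi,\zeta)$ (with $\tau,\zeta\in\mathbb{R}$, $r\ge 0$, and $\phi$ $2\pi$-periodic), by $$ds^2=-d\tau^2-2\sqrt{2}\,\alpha r^2\,d\phi\,d\tau+r^2(1-\alpha^2r^2)\,d\phi^2+\frac{dr^2}{1+\alpha^2r^2}+d\zeta^2,$$ which extends smoothly across the axis $r=0$ in the coordinates $x=r\cos\phi$, $y=r\sin\phi$. It is time-oriented by $\partial/\partial\tau$: a nonzero causal vector $v$ is future-pointing if and only if $g(\partial/\partial\tau,v)<0$. A lightlike path from an event $A$ to an event $B$ is a chain of $n\ge 1$ segments of future-pointing null geodesics (each defined on a parameter interval of positive length), laid end to end, with past endpoint $A$ and future endpoint $B$. Let $\mathcal{O}$ be any event of Gödel's universe. Then every closed lightlike path from $\mathcal{O}$ to $\mathcal{O}$ contains at least $8$ future-pointing null geodesic segments. Furthermore, this bound is attained: there is a closed lightlike path from $\mathcal{O}$ to $\mathcal{O}$ with exactly $8$ segments. -/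

import Mathlib

open Matrix

noncomputable section

namespace Godel

/-- Points of the underlying manifold `ℝ⁴` (and, in this global chart, tangent vectors) in the
coordinates `(τ, x, y, ζ)`, where `x = r cos φ` and `y = r sin φ` are the Cartesian coordinates
attached to the cylindrical coordinates `(τ, r, φ, ζ)`; they also cover the axis `r = 0`. -/
abbrev Event : Type := Fin 4 → ℝ

/-- Components of Gödel's metric with parameter `α` in the coordinates `(τ, x, y, ζ)`, i.e. of
`ds² = - dτ² - 2 √2 α r² dφ dτ + r² (1 - α² r²) dφ² + dr² / (1 + α² r²) + dζ²`; see
`inner_cylindrical` below. -/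
def metric (α : ℝ) (p : Event) : Matrix (Fin 4) (Fin 4) ℝ :=
  let x := p 1
  let y := p 2
  let D := 1 + α ^ 2 * (x ^ 2 + y ^ 2)
  !![-1, √2 * α * y, -(√2 * α * x), 0;
     √2 * α * y, 1 - α ^ 2 * y ^ 2 - α ^ 2 * x ^ 2 / D, α ^ 2 * x * y - α ^ 2 * x * y / D, 0;
     -(√2 * α * x), α ^ 2 * x * y - α ^ 2 * x * y / D, 1 - α ^ 2 * x ^ 2 - α ^ 2 * y ^ 2 / D, 0;
     0, 0, 0, 1]

/-- The value `g_p(v, w)` of Gödel's metric on two tangent vectors at `p`. -/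
def inner (α : ℝ) (p v w : Event) : ℝ := v ⬝ᵥ (metric α p *ᵥ w)

/-- In cylindrical coordinates `inner` is Gödel's line element; `vτ, vr, vφ, vζ` are the
components of the tangent vector with respect to `∂/∂τ, ∂/∂r, ∂/∂φ, ∂/∂ζ`. -/
theorem inner_cylindrical (α τ r φ ζ vτ vr vφ vζ : ℝ) :
    inner α ![τ, r * Real.cos φ, r * Real.sin φ, ζ]
      ![vτ, vr * Real.cos φ - r * Real.sin φ * vφ, vr * Real.sin φ + r * Real.cos φ * vφ, vζ]
      ![vτ, vr * Real.cos φ - r * Real.sin φ * vφ, vr * Real.sin φ + r * Real.cos φ * vφ, vζ] =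
    -vτ ^ 2 - 2 * √2 * α * r ^ 2 * vφ * vτ + r ^ 2 * (1 - α ^ 2 * r ^ 2) * vφ ^ 2
      + vr ^ 2 / (1 + α ^ 2 * r ^ 2) + vζ ^ 2 := by
  have hD : (1 + α ^ 2 * r ^ 2 : ℝ) ≠ 0 := by positivity
  have hs : Real.sin φ ^ 2 = 1 - Real.cos φ ^ 2 := by
    have := Real.sin_sq_add_cos_sq φ
    linarith
  have hr : (r * Real.cos φ) ^ 2 + (r * Real.sin φ) ^ 2 = r ^ 2 := by
    rw [mul_pow, mul_pow, hs]; ring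
  simp [inner, metric, dotProduct, mulVec, Fin.sum_univ_four, hr]
  generalize Real.cos φ = c at *
  generalize Real.sin φ = s at *
  field_simp
  have h4 : s ^ 4 = (1 - c ^ 2) ^ 2 := by rw [← hs]; ring
  ring_nf
  simp only [hs, h4]
  ring

/-- The metric is nondegenerate everywhere, so that the inverse matrix in `christoffel` is the
inverse metric. -/
theorem det_metric (α : ℝ) (p : Event) : (metric α p).det = -1 := by
  have hD : (1 + α ^ 2 * (p 1 ^ 2 + p 2 ^ 2) : ℝ) ≠ 0 := by positivity
  have h2 : √(2 : ℝ) ^ 2 = 2 := Real.sq_sqrt (by norm_num)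
  simp [metric, det_succ_row_zero, Fin.sum_univ_succ, Fin.succAbove]
  field_simp
  ring_nf
  simp only [h2]
  ring

/-- Partial derivative `∂_l g_{ij}` at `p`. -/
def metricDeriv (α : ℝ) (p : Event) (l i j : Fin 4) : ℝ :=
  fderiv ℝ (fun q : Event => metric α q i j) p (Pi.single l 1)

/-- Christoffel symbols `Γ^k_{ij}` of the Levi-Civita connection. -/
def christoffel (α : ℝ) (p : Event) (k i j : Fin 4) : ℝ :=
  1 / 2 * ∑ l, (metric α p)⁻¹ k l *
    (metricDeriv α p i j l + metricDeriv α p j i l - metricDeriv α p l i j)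

/-- `γ` is an (affinely parametrized) geodesic on `I` with tangent vector field `v`:
`γ' = v` and `v'^k + Γ^k_{ij} v^i v^j = 0` (one-sided derivatives at endpoints of `I`). -/
def IsGeodesicOn (α : ℝ) (γ v : ℝ → Event) (I : Set ℝ) : Prop :=
  ∀ s ∈ I, HasDerivWithinAt γ (v s) I s ∧
    HasDerivWithinAt v
      (fun k => -∑ i, ∑ j, christoffel α (γ s) k i j * v s i * v s j) I s

/-- The fluid flow vector `∂/∂τ`, which defines the time orientation. -/
def flow : Event := ![1, 0, 0, 0]

/-- `v` is a future-pointing null vector at `p`. The second condition forces `v ≠ 0`. -/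
def IsFutureNull (α : ℝ) (p v : Event) : Prop :=
  inner α p v v = 0 ∧ inner α p flow v < 0

/-- A segment of a future-pointing null geodesic from `A` to `B`. -/
structure NullGeodesicSegment (α : ℝ) (A B : Event) where
  /-- initial parameter value -/
  a : ℝ
  /-- final parameter value -/
  b : ℝ
  a_lt_b : a < b
  /-- the curve -/
  γ : ℝ → Event
  /-- its tangent vector field -/
  v : ℝ → Event
  geodesic : IsGeodesicOn α γ v (Set.Icc a b)
  futureNull : ∀ s ∈ Set.Icc a b, IsFutureNull α (γ s) (v s)
  source : γ a = A
  target : γ b = B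

/-- A lightlike path from `A` to `B`: a chain of `n ≥ 1` future-pointing null geodesic segments
laid end to end. -/
structure LightlikePath (α : ℝ) (A B : Event) where
  /-- the number of segments -/
  numSegments : ℕ
  numSegments_pos : 0 < numSegments
  /-- the endpoints `A₀, …, Aₙ` of the segments -/
  vertex : Fin (numSegments + 1) → Event
  source : vertex 0 = A
  target : vertex (Fin.last numSegments) = B
  /-- the segments -/
  segment : ∀ i : Fin numSegments, NullGeodesicSegment α (vertex i.castSucc) (vertex i.succ)

end Godel

end

/-!
Gödel's universe is the product of the `ζ`-line with a three-dimensional spacetime whose fluid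
lines (the integral curves of `∂/∂τ`) form a hyperbolic plane. With `τ` taken modulo a period,
that spacetime is the group `SU(1, 1)` with a metric invariant under right translations, which are
the changes of base event. In the matrix entries `A = ampA`, `B = ampB` geodesic motion becomes a
linear system with a uniformly rotating coefficient, which is solved explicitly
(`spinor_solution`, `spinor`); this persists for the amplitudes `relA c`, `relB c` relative to a
base event `c`. The modulus of `relA c p` measures the hyperbolic distance between the fluid lines
of `c` and `p`, and its argument, lifted to the real number `relAngle c p`, is a time coordinate
relative to `c`, with the orientation reversed.

Along a null geodesic segment from `p` to `q` one has `relAngle c q - relAngle c p = turn - delay`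
(`IsGeodesicOn.relAngle_sub`). Here `turn` is half the signed area of the hyperbolic triangle
`c p q`, determined by its side lengths (`cos_turn`), and the delay is positive and at least
`minDelay` times the chord `S`, the hyperbolic sine of half the distance between the fluid lines of
`p` and `q`, which is at most `1` (`minDelay_mul_abs_le_delay`). A closed path must therefore project to a polygon that
encloses enough area to pay for all its delays.

Lower bound. Take the first vertex of a closed path as base event `c`. A step can gain much area
only at a large distance from `c`, and the distance must be built up and undone. This is expressed
by the monotonicity of `relAngle + weight k * log ‖relA‖` along the vertices `k = 1, …, 6`
(`NullGeodesicSegment.weightedAngle_succ_le`). The step inequalities behind it (`turn_le_outer`,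
`turn_le_middle`, `turn_le_inner` and their time reversals) are reduced to the positivity of
functions of `S` alone (`turn_le_of_profile`), which is checked at finitely many points by
convexity (`profile_nonneg`). The first step makes the quantity strictly smaller than its value at
`c`, and neither closing up at one of these vertices nor one further segment back to `c` can make
up for it.

Attainment. Choose `c` off the fluid line of the given event and follow a null geodesic for half a
turn, with parameters such that it keeps `relA` and `relAngle` and rotates `relB` by `π / 4`
(`exists_octagon_parameters`, `exists_octagon_side`). Eight such segments form a regular octagon
around `c`, and alternating the sign of the velocity in direction `ζ` brings `ζ` back as well. The
geodesics are constructed from the explicit solution of the linear system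
(`exists_nullGeodesicSegment`).
-/

noncomputable section

namespace Godel

/-! ### The geodesic equation in coordinates -/

/-- The partial derivative `∂_l g_{ij}` of Gödel's metric as an explicit rational expression. -/
def metricPartial (α : ℝ) (p : Event) (l i j : Fin 4) : ℝ :=
  let x := p 1
  let y := p 2
  let D := 1 + α ^ 2 * (x ^ 2 + y ^ 2)
  (![0,
    !![0, 0, -(√2 * α), 0;
       0, -(2 * α ^ 2 * x) / D + 2 * (α ^ 2) ^ 2 * x ^ 3 / D ^ 2,
         α ^ 2 * y - α ^ 2 * y / D + 2 * (α ^ 2) ^ 2 * x ^ 2 * y / D ^ 2, 0;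
       -(√2 * α), α ^ 2 * y - α ^ 2 * y / D + 2 * (α ^ 2) ^ 2 * x ^ 2 * y / D ^ 2,
         -(2 * α ^ 2 * x) + 2 * (α ^ 2) ^ 2 * x * y ^ 2 / D ^ 2, 0;
       0, 0, 0, 0],
    !![0, √2 * α, 0, 0;
       √2 * α, -(2 * α ^ 2 * y) + 2 * (α ^ 2) ^ 2 * x ^ 2 * y / D ^ 2,
         α ^ 2 * x - α ^ 2 * x / D + 2 * (α ^ 2) ^ 2 * x * y ^ 2 / D ^ 2, 0;
       0, α ^ 2 * x - α ^ 2 * x / D + 2 * (α ^ 2) ^ 2 * x * y ^ 2 / D ^ 2,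
         -(2 * α ^ 2 * y) / D + 2 * (α ^ 2) ^ 2 * y ^ 3 / D ^ 2, 0;
       0, 0, 0, 0],
    0] : Fin 4 → Matrix (Fin 4) (Fin 4) ℝ) l i j

/-- A coordinate partial derivative, defined through `fderiv`, is computed along the coordinate
line. -/
theorem fderiv_single {f : Event → ℝ} {p : Event} {l : Fin 4} {d : ℝ}
    (hf : DifferentiableAt ℝ f p)
    (h : HasDerivAt (fun t => f (Function.update p l t)) d (p l)) :
    fderiv ℝ f p (Pi.single l 1) = d := by
  have h1 : HasDerivAt (Function.update p l) (Pi.single l 1) (p l) := by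
    have := hasDerivAt_update (𝕜 := ℝ) p l (p l)
    exact this
  have h2 := hf.hasFDerivAt
  have h3 : HasFDerivAt f (fderiv ℝ f p) (Function.update p l (p l)) := by
    simpa using h2
  exact (h3.comp_hasDerivAt _ h1).unique h

theorem differentiable_metric (α : ℝ) (i j : Fin 4) :
    Differentiable ℝ (fun q : Event => metric α q i j) := by
  intro p
  have hD : (1 + α ^ 2 * (p 1 ^ 2 + p 2 ^ 2) : ℝ) ≠ 0 := by positivity
  fin_cases i <;> fin_cases j <;> simp [metric] <;> fun_prop (disch := exact hD)

theorem metricDeriv_eq (α : ℝ) (p : Event) (l i j : Fin 4) :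
    metricDeriv α p l i j = metricPartial α p l i j := by
  refine fderiv_single (differentiable_metric α i j p) ?_
  have hinv : ∀ (d : ℝ → ℝ) (d' s : ℝ), HasDerivAt d d' s → d s ≠ 0 →
      HasDerivAt (fun t => (d t)⁻¹) (-d' / d s ^ 2) s := fun d d' s h h0 => h.inv h0
  have hD : (1 + α ^ 2 * (p 1 ^ 2 + p 2 ^ 2) : ℝ) ≠ 0 := by positivity
  have hD1 : HasDerivAt (fun t => (1 + α ^ 2 * (t ^ 2 + p 2 ^ 2))⁻¹)
      (-(α ^ 2 * (2 * p 1)) / (1 + α ^ 2 * (p 1 ^ 2 + p 2 ^ 2)) ^ 2) (p 1) := by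
    refine hinv _ _ _ ?_ hD
    have := ((((hasDerivAt_id (p 1)).pow 2).add_const (p 2 ^ 2)).const_mul (α ^ 2)).const_add 1
    simpa using this
  have hD2 : HasDerivAt (fun t => (1 + α ^ 2 * (p 1 ^ 2 + t ^ 2))⁻¹)
      (-(α ^ 2 * (2 * p 2)) / (1 + α ^ 2 * (p 1 ^ 2 + p 2 ^ 2)) ^ 2) (p 2) := by
    refine hinv _ _ _ ?_ hD
    have := ((((hasDerivAt_id (p 2)).pow 2).const_add (p 1 ^ 2)).const_mul (α ^ 2)).const_add 1
    simpa using this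
  have hI1 := hasDerivAt_id (p 1)
  have hI2 := hasDerivAt_id (p 2)
  have hS1 : HasDerivAt (fun t : ℝ => t ^ 2) (2 * p 1) (p 1) := by
    simpa using hasDerivAt_pow 2 (p 1)
  have hS2 : HasDerivAt (fun t : ℝ => t ^ 2) (2 * p 2) (p 2) := by
    simpa using hasDerivAt_pow 2 (p 2)
  have hz : ∀ c s : ℝ, HasDerivAt (fun _ : ℝ => c) 0 s := fun c s => hasDerivAt_const s c
  fin_cases l
  · fin_cases i <;> fin_cases j <;>
      simp only [metric, metricPartial, of_apply, cons_val, Fin.zero_eta, Fin.mk_one,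
        Fin.reduceFinMk, Matrix.zero_apply, ne_eq,
        Fin.reduceEq, not_false_eq_true, Function.update_of_ne, one_ne_zero] <;>
      exact hz _ _
  · fin_cases i <;> fin_cases j <;>
      simp only [metric, metricPartial, of_apply, cons_val, Fin.zero_eta, Fin.mk_one,
        Fin.reduceFinMk, Function.update_self, ne_eq,
        Fin.reduceEq, not_false_eq_true, Function.update_of_ne]
    all_goals try exact hz _ _
    · exact ((hI1.const_mul (√2 * α)).neg).congr_deriv (by simp)
    · have := (hS1.const_mul (α ^ 2) |>.mul hD1).const_sub (1 - α ^ 2 * p 2 ^ 2)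
      refine this.congr_deriv ?_
      try simp only [id]
      field_simp; ring
    · have := (hI1.const_mul (α ^ 2) |>.mul_const (p 2)).sub
        ((hI1.const_mul (α ^ 2) |>.mul_const (p 2)).mul hD1)
      refine this.congr_deriv ?_
      try simp only [id]
      field_simp; ring
    · exact ((hI1.const_mul (√2 * α)).neg).congr_deriv (by simp)
    · have := (hI1.const_mul (α ^ 2) |>.mul_const (p 2)).sub
        ((hI1.const_mul (α ^ 2) |>.mul_const (p 2)).mul hD1)
      refine this.congr_deriv ?_
      try simp only [id]
      field_simp; ring
    · have := ((hS1.const_mul (α ^ 2)).const_sub 1).sub (hD1.const_mul (α ^ 2 * p 2 ^ 2))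
      refine this.congr_deriv ?_
      try simp only [id]
      field_simp; ring
  · fin_cases i <;> fin_cases j <;>
      simp only [metric, metricPartial, of_apply, cons_val, Fin.zero_eta, Fin.mk_one,
        Fin.reduceFinMk, Function.update_self, ne_eq,
        Fin.reduceEq, not_false_eq_true, Function.update_of_ne]
    all_goals try exact hz _ _
    · simpa using hI2.const_mul (√2 * α)
    · simpa using hI2.const_mul (√2 * α)
    · have := ((hS2.const_mul (α ^ 2)).const_sub 1).sub (hD2.const_mul (α ^ 2 * p 1 ^ 2))
      refine this.congr_deriv ?_
      try simp only [id]
      field_simp; ring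
    · have := (hI2.const_mul (α ^ 2 * p 1)).sub ((hI2.const_mul (α ^ 2 * p 1)).mul hD2)
      refine this.congr_deriv ?_
      try simp only [id]
      field_simp; ring
    · have := (hI2.const_mul (α ^ 2 * p 1)).sub ((hI2.const_mul (α ^ 2 * p 1)).mul hD2)
      refine this.congr_deriv ?_
      try simp only [id]
      field_simp; ring
    · have := (hS2.const_mul (α ^ 2) |>.mul hD2).const_sub (1 - α ^ 2 * p 1 ^ 2)
      refine this.congr_deriv ?_
      try simp only [id]
      field_simp; ring
  · fin_cases i <;> fin_cases j <;>
      simp only [metric, metricPartial, of_apply, cons_val, Fin.zero_eta, Fin.mk_one,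
        Fin.reduceFinMk, Matrix.zero_apply, ne_eq,
        Fin.reduceEq, not_false_eq_true, Function.update_of_ne] <;>
      exact hz _ _

/-- Minus the inner product of `v` with `∂/∂τ` (see `inner_flow`). As `∂/∂τ` is a Killing field,
it is conserved along geodesics; it is positive on future-pointing causal vectors. -/
def energy (α : ℝ) (p v : Event) : ℝ := v 0 + √2 * α * (p 1 * v 2 - p 2 * v 1)

/-- The second derivative `-Γ^k_{ij} v^i v^j` prescribed by the geodesic equation in position `p`
with velocity `v`, in closed form (see `christoffel_sum`). -/
def accel (α : ℝ) (p v : Event) : Event :=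
  let x := p 1
  let y := p 2
  let D := 1 + α ^ 2 * (x ^ 2 + y ^ 2)
  let u := x * v 1 + y * v 2
  let F := √2 * α * (v 0 + energy α p v)
  let N := α ^ 2 * (v 1 ^ 2 + v 2 ^ 2) - (α ^ 2) ^ 2 * u ^ 2 / D
  ![-(√2 * α * F * u / D),
    -(F * (D * v 2 - y * (α ^ 2 * u) * (1 + 1 / D))) + x * N,
    F * (D * v 1 - x * (α ^ 2 * u) * (1 + 1 / D)) + y * N, 0]

/-- The covariant form of `christoffel_sum`, with the index lowered, which avoids the inverse
metric. -/
theorem metric_mulVec_accel (α : ℝ) (p v : Event) :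
    metric α p *ᵥ accel α p v = fun l => -(1 / 2) * ∑ i, ∑ j,
      (metricPartial α p i j l + metricPartial α p j i l - metricPartial α p l i j) *
        v i * v j := by
  have hD : (1 + α ^ 2 * (p 1 ^ 2 + p 2 ^ 2) : ℝ) ≠ 0 := by positivity
  have h2 : α ^ 2 = (√2 * α) ^ 2 / 2 := by
    rw [mul_pow, Real.sq_sqrt (by norm_num : (0 : ℝ) ≤ 2)]; ring
  ext l
  fin_cases l <;>
    simp only [metric, accel, energy, metricPartial, mulVec, dotProduct, Fin.sum_univ_four,
      of_apply, cons_val, Fin.reduceFinMk, Fin.mk_one, Fin.zero_eta, Matrix.zero_apply, zero_mul,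
      mul_zero, zero_add, add_zero, sub_zero]
  all_goals
    try simp only [h2] at hD ⊢
    generalize √2 * α = β at *
    generalize p 1 = x at *
    generalize p 2 = y at *
    generalize v 0 = v0 at *
    generalize v 1 = v1 at *
    generalize v 2 = v2 at *
    have hI := mul_inv_cancel₀ hD
    try simp only [div_eq_mul_inv _ (1 + _ * (_ + _) : ℝ), one_mul,
      div_eq_mul_inv _ ((1 + _ * (_ + _)) ^ 2 : ℝ)] at hI ⊢
    generalize (1 + β ^ 2 / 2 * (x ^ 2 + y ^ 2))⁻¹ = I at *
    grind

/-- The inverse metric cancels against the metric in `metric_mulVec_accel`. -/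
theorem christoffel_sum (α : ℝ) (p v : Event) :
    (fun k => -∑ i, ∑ j, christoffel α p k i j * v i * v j) = accel α p v := by
  have hdet : IsUnit (metric α p).det := by rw [det_metric]; norm_num
  have h := congrArg (fun w => (metric α p)⁻¹ *ᵥ w) (metric_mulVec_accel α p v)
  simp only [mulVec_mulVec, nonsing_inv_mul _ hdet, one_mulVec] at h
  rw [h]
  ext k
  simp only [christoffel, mulVec, dotProduct, metricDeriv_eq]
  simp only [Finset.mul_sum, Finset.sum_mul, ← Finset.sum_neg_distrib]
  rw [Finset.sum_comm (s := Finset.univ (α := Fin 4)) (t := Finset.univ (α := Fin 4))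
    (f := fun l i => ∑ j, (metric α p)⁻¹ k l * (-(1 / 2) * ((metricPartial α p i j l +
      metricPartial α p j i l - metricPartial α p l i j) * v i * v j)))]
  refine Finset.sum_congr rfl fun i _ => ?_
  rw [Finset.sum_comm]
  exact Finset.sum_congr rfl fun l _ => Finset.sum_congr rfl fun j _ => by ring

/-! ### Amplitudes and their evolution along geodesics -/

section

open Complex ComplexConjugate

/-- `√(1 + α²r²)`, the hyperbolic cosine of half the hyperbolic distance from the axis, in the
metric of curvature `-1` on the plane of fluid lines. -/
def stretch (α : ℝ) (p : Event) : ℝ := √(1 + α ^ 2 * (p 1 ^ 2 + p 2 ^ 2))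

/-- The complex coordinate `α (x + i y)` on the plane of fluid lines. Applied to a tangent vector
it is the component of that vector in this plane. -/
def plane (α : ℝ) (p : Event) : ℂ := ⟨α * p 1, α * p 2⟩

/-- The frequency `α / √2` at which `phase` rotates in the time coordinate `τ`. -/
def rate (α : ℝ) : ℝ := √2 * α / 2

/-- The unit complex number `exp (-i τ α / √2)`; it forgets `τ` modulo a period. -/
def phase (α : ℝ) (p : Event) : ℂ := cexp (-(rate α * p 0 : ℝ) * I)

/-- First entry of the matrix `(A, B; conj B, conj A)` in `SU(1, 1)` that represents the
coordinates `(τ, x, y)` of an event, with `τ` taken modulo a period. -/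
def ampA (α : ℝ) (p : Event) : ℂ := stretch α p * phase α p

/-- Second entry of the matrix in `SU(1, 1)` that represents an event; see `ampA`. -/
def ampB (α : ℝ) (p : Event) : ℂ := plane α p * phase α p

/-- The velocity in the plane of fluid lines, read in a frame that is orthogonal to `∂/∂τ` and of
constant length: `|baseVel|²` is `α²` times the squared length of the projection of `v` to the
plane (see `normSq_baseVel`). Along a geodesic it turns but keeps its length. -/
def baseVel (α : ℝ) (p v : Event) : ℂ :=
  ⟨α * (stretch α p * v 1 - p 1 * (α ^ 2 * (p 1 * v 1 + p 2 * v 2) / stretch α p)),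
    α * (stretch α p * v 2 - p 2 * (α ^ 2 * (p 1 * v 1 + p 2 * v 2) / stretch α p))⟩

/-- `baseVel` in the frame carried along by `phase`. Along a geodesic it rotates uniformly, which
makes the equations of motion of `ampA` and `ampB` linear with explicitly known coefficients. -/
def ampV (α : ℝ) (p v : Event) : ℂ := baseVel α p v * phase α p ^ 2

theorem stretch_sq (α : ℝ) (p : Event) :
    stretch α p ^ 2 = 1 + α ^ 2 * (p 1 ^ 2 + p 2 ^ 2) := Real.sq_sqrt (by positivity)

theorem stretch_pos (α : ℝ) (p : Event) : 0 < stretch α p := Real.sqrt_pos.2 (by positivity)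

theorem normSq_plane (α : ℝ) (p : Event) : normSq (plane α p) = stretch α p ^ 2 - 1 := by
  rw [stretch_sq, plane, normSq_mk]; ring

theorem phase_mul_conj (α : ℝ) (p : Event) : phase α p * conj (phase α p) = 1 := by
  rw [phase, ← exp_conj, ← exp_add]
  simp

theorem rate_sq (α : ℝ) : 2 * rate α ^ 2 = α ^ 2 := by
  rw [rate, div_pow, mul_pow, Real.sq_sqrt (by norm_num : (0 : ℝ) ≤ 2)]; ring

theorem ampA_mul_conj (α : ℝ) (p : Event) :
    ampA α p * conj (ampA α p) - ampB α p * conj (ampB α p) = 1 := by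
  have h1 := phase_mul_conj α p
  have h2 : plane α p * conj (plane α p) = (stretch α p : ℂ) ^ 2 - 1 := by
    rw [mul_conj, normSq_plane]; push_cast; ring
  simp only [ampA, ampB, map_mul, conj_ofReal]
  linear_combination ((stretch α p : ℂ) ^ 2 - plane α p * conj (plane α p)) * h1 - h2

theorem baseVel_mul_conj (α : ℝ) (p v : Event) :
    baseVel α p v * conj (plane α p) =
      (α ^ 2 * (p 1 * v 1 + p 2 * v 2) / stretch α p : ℝ) +
        (rate α * (energy α p v - v 0) * stretch α p : ℝ) * I := by
  have h1 := stretch_sq α p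
  have h2 := (stretch_pos α p).ne'
  have h3 : rate α * (√2 * α) = α ^ 2 := by rw [← rate_sq, rate]; ring
  apply Complex.ext
  · simp only [baseVel, plane, mul_re, conj_re, conj_im, add_re, ofReal_re, ofReal_im, I_re, I_im]
    field_simp
    linear_combination α ^ 2 * (p 1 * v 1 + p 2 * v 2) * h1
  · simp only [baseVel, plane, energy, mul_im, conj_re, conj_im, add_im, ofReal_re, ofReal_im, I_re,
      I_im]
    linear_combination -(p 1 * v 2 - p 2 * v 1) * stretch α p * h3

theorem baseVel_mul_stretch (α : ℝ) (p v : Event) :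
    baseVel α p v * stretch α p =
      plane α v + (rate α * (energy α p v - v 0) : ℝ) * I * plane α p := by
  have h1 := stretch_sq α p
  have h2 := (stretch_pos α p).ne'
  have h3 : rate α * (√2 * α) = α ^ 2 := by rw [← rate_sq, rate]; ring
  apply Complex.ext
  · simp [baseVel, plane, energy]
    field_simp
    linear_combination α * v 1 * h1 + α * (p 1 * v 2 - p 2 * v 1) * p 2 * h3
  · simp [baseVel, plane, energy]
    field_simp
    linear_combination α * v 2 * h1 - α * (p 1 * v 2 - p 2 * v 1) * p 1 * h3

theorem normSq_baseVel (α : ℝ) (p v : Event) :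
    normSq (baseVel α p v) = α ^ 2 * (inner α p v v + energy α p v ^ 2 - v 3 ^ 2) := by
  have h1 := stretch_sq α p
  have h2 := (stretch_pos α p).ne'
  have hD : (1 + α ^ 2 * (p 1 ^ 2 + p 2 ^ 2) : ℝ) ≠ 0 := by positivity
  have h3 : √(2 : ℝ) ^ 2 = 2 := Real.sq_sqrt (by norm_num)
  have hp := mul_inv_cancel₀ h2
  have hK : (stretch α p ^ 2)⁻¹ = (stretch α p)⁻¹ ^ 2 := (inv_pow _ _).symm
  simp only [baseVel, inner, energy, metric, normSq_mk, mulVec, dotProduct,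
    Fin.sum_univ_four, of_apply, cons_val, div_eq_mul_inv, ← h1, hK]
  generalize (stretch α p)⁻¹ = K at *
  generalize stretch α p = a at *
  generalize √2 = r at *
  generalize p 1 = x at *
  generalize p 2 = y at *
  generalize v 0 = v0 at *
  generalize v 1 = v1 at *
  generalize v 2 = v2 at *
  generalize v 3 = v3 at *
  grind

theorem hasDerivWithinAt_mk {f g : ℝ → ℝ} {f' g' s : ℝ} {J : Set ℝ}
    (hf : HasDerivWithinAt f f' J s) (hg : HasDerivWithinAt g g' J s) :
    HasDerivWithinAt (fun t => (⟨f t, g t⟩ : ℂ)) ⟨f', g'⟩ J s := by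
  have h := hf.ofReal_comp.add (hg.ofReal_comp.mul_const I)
  have e : ∀ x y : ℝ, (⟨x, y⟩ : ℂ) = (x : ℂ) + (y : ℂ) * I := fun x y => by
    apply Complex.ext <;> simp
  simp only [e]
  exact h

section geodesic

variable {α : ℝ} {γ v : ℝ → Event} {J : Set ℝ} {s : ℝ}

/-- The geodesic equation with the Christoffel symbols evaluated. -/
theorem IsGeodesicOn.hasDerivWithinAt_vel (h : IsGeodesicOn α γ v J) (hs : s ∈ J) :
    HasDerivWithinAt v (accel α (γ s) (v s)) J s := by
  rw [← christoffel_sum]; exact (h s hs).2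

theorem hasDerivWithinAt_stretch (hγ : HasDerivWithinAt γ (v s) J s) :
    HasDerivWithinAt (fun t => stretch α (γ t))
      (α ^ 2 * (γ s 1 * v s 1 + γ s 2 * v s 2) / stretch α (γ s)) J s := by
  have h := hasDerivWithinAt_pi.1 hγ
  have h1 := (((h 1).pow 2).add ((h 2).pow 2)).const_mul (α ^ 2) |>.const_add 1 |>.sqrt
    (by have : 0 < 1 + α ^ 2 * (γ s 1 ^ 2 + γ s 2 ^ 2) := by positivity
        exact this.ne')
  refine h1.congr_deriv ?_
  simp only [Pi.pow_apply, Pi.add_apply, stretch]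
  rw [div_eq_div_iff (by positivity) (by positivity)]
  push_cast
  ring

theorem hasDerivWithinAt_plane (hγ : HasDerivWithinAt γ (v s) J s) :
    HasDerivWithinAt (fun t => plane α (γ t)) (plane α (v s)) J s := by
  have h := hasDerivWithinAt_pi.1 hγ
  exact hasDerivWithinAt_mk ((h 1).const_mul α) ((h 2).const_mul α)

theorem hasDerivWithinAt_phase (hγ : HasDerivWithinAt γ (v s) J s) :
    HasDerivWithinAt (fun t => phase α (γ t)) (-(rate α * v s 0 : ℝ) * I * phase α (γ s)) J s := by
  have h := (hasDerivWithinAt_pi.1 hγ) 0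
  have h1 := ((h.const_mul (rate α)).neg.ofReal_comp.mul_const I).cexp
  refine (h1.congr_deriv ?_).congr ?_ ?_
  all_goals simp [phase]
  ring

/-- With energy `E` the amplitudes satisfy `A' = -i ρ E A + V conj B` and
`B' = -i ρ E B + V conj A`, where `ρ = rate α`. This holds on any curve; the geodesic equation
enters through `E` and `V`. -/
theorem hasDerivWithinAt_ampA (hγ : HasDerivWithinAt γ (v s) J s) :
    HasDerivWithinAt (fun t => ampA α (γ t))
      (-(rate α * energy α (γ s) (v s) : ℝ) * I * ampA α (γ s) +
        ampV α (γ s) (v s) * conj (ampB α (γ s))) J s := by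
  refine ((hasDerivWithinAt_stretch hγ).ofReal_comp.mul (hasDerivWithinAt_phase hγ)).congr_deriv ?_
  have h1 := phase_mul_conj α (γ s)
  have h2 := baseVel_mul_conj α (γ s) (v s)
  simp only [ampA, ampB, ampV, map_mul]
  push_cast at h2 ⊢
  linear_combination (-phase α (γ s)) * h2 -
    baseVel α (γ s) (v s) * conj (plane α (γ s)) * phase α (γ s) * h1

theorem hasDerivWithinAt_ampB (hγ : HasDerivWithinAt γ (v s) J s) :
    HasDerivWithinAt (fun t => ampB α (γ t))
      (-(rate α * energy α (γ s) (v s) : ℝ) * I * ampB α (γ s) +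
        ampV α (γ s) (v s) * conj (ampA α (γ s))) J s := by
  refine ((hasDerivWithinAt_plane hγ).mul (hasDerivWithinAt_phase hγ)).congr_deriv ?_
  have h1 := phase_mul_conj α (γ s)
  have h2 := baseVel_mul_stretch α (γ s) (v s)
  simp only [ampA, ampB, ampV, map_mul, conj_ofReal]
  push_cast at h2 ⊢
  linear_combination (-phase α (γ s)) * h2 -
    baseVel α (γ s) (v s) * stretch α (γ s) * phase α (γ s) * h1

theorem IsGeodesicOn.hasDerivWithinAt_energy (h : IsGeodesicOn α γ v J) (hs : s ∈ J) :
    HasDerivWithinAt (fun t => energy α (γ t) (v t)) 0 J s := by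
  have h1 := hasDerivWithinAt_pi.1 (h s hs).1
  have h2 := hasDerivWithinAt_pi.1 (h.hasDerivWithinAt_vel hs)
  have h3 := (h2 0).add ((((h1 1).mul (h2 2)).sub ((h1 2).mul (h2 1))).const_mul (√2 * α))
  refine h3.congr_deriv ?_
  have hD : (1 + α ^ 2 * (γ s 1 ^ 2 + γ s 2 ^ 2) : ℝ) ≠ 0 := by positivity
  have hI := mul_inv_cancel₀ hD
  simp only [accel, cons_val]
  simp only [div_eq_mul_inv _ (1 + _ * (_ + _) : ℝ), one_mul] at hI ⊢
  generalize (1 + α ^ 2 * (γ s 1 ^ 2 + γ s 2 ^ 2))⁻¹ = I at *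
  grind

/-- Magnetic deflection: the horizontal velocity turns at a speed depending on the velocity of
`τ`. -/
theorem IsGeodesicOn.hasDerivWithinAt_baseVel (h : IsGeodesicOn α γ v J) (hs : s ∈ J) :
    HasDerivWithinAt (fun t => baseVel α (γ t) (v t))
      ((√2 * α * (v s 0 + energy α (γ s) (v s)) : ℝ) * I * baseVel α (γ s) (v s)) J s := by
  have h1 := hasDerivWithinAt_pi.1 (h s hs).1
  have h2 := hasDerivWithinAt_pi.1 (h.hasDerivWithinAt_vel hs)
  have hst := hasDerivWithinAt_stretch (α := α) (h s hs).1
  have h3 := (((((h1 1).mul (h2 1)).add ((h1 2).mul (h2 2))).const_mul (α ^ 2)).div hst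
    (stretch_pos α _).ne')
  have h4 := hasDerivWithinAt_mk
    (((hst.mul (h2 1)).sub ((h1 1).mul h3)).const_mul α)
    (((hst.mul (h2 2)).sub ((h1 2).mul h3)).const_mul α)
  refine h4.congr_deriv ?_
  clear h4 h3 hst h1 h2
  have hD := (stretch_pos α (γ s)).ne'
  have hsq := stretch_sq α (γ s)
  have hp := mul_inv_cancel₀ hD
  have hK : (stretch α (γ s) ^ 2)⁻¹ = (stretch α (γ s))⁻¹ ^ 2 := (inv_pow _ _).symm
  apply Complex.ext
  all_goals
    simp only [baseVel, accel, cons_val, div_eq_mul_inv, ← hsq, hK, mul_re, mul_im, I_re, I_im,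
      ofReal_re, ofReal_im, Pi.mul_apply, Pi.add_apply, Pi.div_apply]
    generalize (stretch α (γ s))⁻¹ = K at *
    generalize (stretch α (γ s)) = a at *
    generalize energy α (γ s) (v s) = e at *
    generalize √2 = r at *
    generalize γ s 1 = x at *
    generalize γ s 2 = y at *
    generalize v s 1 = v1 at *
    generalize v s 2 = v2 at *
    generalize v s 0 = v0 at *
    grind

/-- The velocity of `τ` cancels against the phase, leaving a uniform rotation at speed `2 ρ E`. -/
theorem IsGeodesicOn.hasDerivWithinAt_ampV (h : IsGeodesicOn α γ v J) (hs : s ∈ J) :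
    HasDerivWithinAt (fun t => ampV α (γ t) (v t))
      ((2 * rate α * energy α (γ s) (v s) : ℝ) * I * ampV α (γ s) (v s)) J s := by
  refine ((h.hasDerivWithinAt_baseVel hs).mul
    ((hasDerivWithinAt_phase (α := α) (h s hs).1).pow 2)).congr_deriv ?_
  simp only [ampV, rate]
  push_cast
  simp
  ring

end geodesic

end

/-! ### The delay function -/

/-- The continuous argument in `σ` of `cos σ + i κ sin σ`, which vanishes at `σ = 0` (see
`exp_windAngle`). -/
def windAngle (κ σ : ℝ) : ℝ :=
  σ + Real.arctan ((κ - 1) * (Real.sin σ * Real.cos σ) / (Real.cos σ ^ 2 + κ * Real.sin σ ^ 2))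

/-- The amount by which the angular coordinate `relAngle` drops along a null geodesic, apart from
the area term `turn`, as a function of the arc parameter `σ`; `κ` runs over `[1, √2]`, with
`κ = √2` for the geodesics of constant `ζ` and `κ = 1` for the lines in direction `∂/∂τ ± ∂/∂ζ`.
-/
def delay (κ σ : ℝ) : ℝ := windAngle κ σ - κ * σ / 2

/-- The delay of a half turn (`σ = π / 2`) of a null geodesic with constant `ζ`; it bounds the
ratio of delay to chord from below. -/
def minDelay : ℝ := Real.pi / 2 * (1 - √2 / 2)

theorem cos_sq_add_pos {κ : ℝ} (hκ : 0 < κ) (σ : ℝ) :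
    0 < Real.cos σ ^ 2 + κ * Real.sin σ ^ 2 := by
  have h := Real.sin_sq_add_cos_sq σ
  rcases eq_or_ne (Real.sin σ) 0 with h0 | h0
  · rw [h0] at h ⊢; nlinarith
  · positivity

theorem hasDerivAt_windAngle {κ : ℝ} (hκ : 0 < κ) (σ : ℝ) :
    HasDerivAt (windAngle κ) (κ / (Real.cos σ ^ 2 + κ ^ 2 * Real.sin σ ^ 2)) σ := by
  have h0 := (cos_sq_add_pos hκ σ).ne'
  have h1 := (cos_sq_add_pos (pow_pos hκ 2) σ).ne'
  have hs := Real.hasDerivAt_sin σ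
  have hc := Real.hasDerivAt_cos σ
  have h := (hasDerivAt_id σ).add
    ((((hs.mul hc).const_mul (κ - 1)).div ((hc.pow 2).add ((hs.pow 2).const_mul κ)) h0).arctan)
  refine h.congr_deriv ?_
  have hsc := Real.sin_sq_add_cos_sq σ
  simp only [Pi.mul_apply, Pi.div_apply, Pi.add_apply, Pi.pow_apply]
  generalize Real.sin σ = s at *
  generalize Real.cos σ = c at *
  have e : (c ^ 2 + κ * s ^ 2) ^ 2 + ((κ - 1) * (s * c)) ^ 2 = c ^ 2 + κ ^ 2 * s ^ 2 := by
    linear_combination (c ^ 2 + κ ^ 2 * s ^ 2) * hsc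
  have e2 : 1 + ((κ - 1) * (s * c) / (c ^ 2 + κ * s ^ 2)) ^ 2 =
      (c ^ 2 + κ ^ 2 * s ^ 2) / (c ^ 2 + κ * s ^ 2) ^ 2 := by
    rw [← e]; field_simp
  rw [e2]
  field_simp
  push_cast
  linear_combination ((κ - 1) * c ^ 2 + κ + (κ - κ ^ 2) * s ^ 2) * hsc

theorem hasDerivAt_windAngle_left {κ : ℝ} (hκ : 0 < κ) (σ : ℝ) :
    HasDerivAt (fun k => windAngle k σ)
      (Real.sin σ * Real.cos σ / (Real.cos σ ^ 2 + κ ^ 2 * Real.sin σ ^ 2)) κ := by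
  have h0 := (cos_sq_add_pos hκ σ).ne'
  have h1 := (cos_sq_add_pos (pow_pos hκ 2) σ).ne'
  have hi := hasDerivAt_id κ
  have h := (((hi.sub_const 1).mul_const (Real.sin σ * Real.cos σ)).div
    ((hi.mul_const (Real.sin σ ^ 2)).const_add (Real.cos σ ^ 2)) h0).arctan.const_add σ
  refine h.congr_deriv ?_
  have hsc := Real.sin_sq_add_cos_sq σ
  simp only [Pi.div_apply, id]
  generalize Real.sin σ = s at *
  generalize Real.cos σ = c at *
  have e : (c ^ 2 + κ * s ^ 2) ^ 2 + ((κ - 1) * (s * c)) ^ 2 = c ^ 2 + κ ^ 2 * s ^ 2 := by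
    linear_combination (c ^ 2 + κ ^ 2 * s ^ 2) * hsc
  have e2 : 1 + ((κ - 1) * (s * c) / (c ^ 2 + κ * s ^ 2)) ^ 2 =
      (c ^ 2 + κ ^ 2 * s ^ 2) / (c ^ 2 + κ * s ^ 2) ^ 2 := by
    rw [← e]; field_simp
  rw [e2]
  field_simp
  linear_combination s * c * hsc

theorem exp_windAngle {κ : ℝ} (hκ : 0 < κ) (σ : ℝ) :
    (Real.cos σ : ℂ) + κ * Real.sin σ * Complex.I =
      (√(Real.cos σ ^ 2 + κ ^ 2 * Real.sin σ ^ 2) : ℝ) *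
        Complex.exp (windAngle κ σ * Complex.I) := by
  have h0 := (cos_sq_add_pos hκ σ)
  have hsc := Real.sin_sq_add_cos_sq σ
  have e : (Real.cos σ ^ 2 + κ * Real.sin σ ^ 2) ^ 2 + ((κ - 1) * (Real.sin σ * Real.cos σ)) ^ 2 =
      Real.cos σ ^ 2 + κ ^ 2 * Real.sin σ ^ 2 := by
    linear_combination (Real.cos σ ^ 2 + κ ^ 2 * Real.sin σ ^ 2) * hsc
  set D := Real.cos σ ^ 2 + κ * Real.sin σ ^ 2 with hD
  set N := (κ - 1) * (Real.sin σ * Real.cos σ) with hN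
  have hr : √(1 + (N / D) ^ 2) = √(Real.cos σ ^ 2 + κ ^ 2 * Real.sin σ ^ 2) / D := by
    rw [← e, eq_div_iff h0.ne', ← Real.sqrt_sq h0.le, ← Real.sqrt_mul (by positivity),
      Real.sqrt_sq h0.le]
    congr 1
    field_simp
  have hpos : 0 < √(Real.cos σ ^ 2 + κ ^ 2 * Real.sin σ ^ 2) :=
    Real.sqrt_pos.2 (cos_sq_add_pos (pow_pos hκ 2) σ)
  have hw : windAngle κ σ = σ + Real.arctan (N / D) := rfl
  generalize √(Real.cos σ ^ 2 + κ ^ 2 * Real.sin σ ^ 2) = R at hr hpos ⊢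
  have hc : Real.cos (windAngle κ σ) * R = Real.cos σ := by
    rw [hw, Real.cos_add, Real.cos_arctan, Real.sin_arctan, hr]
    field_simp
    rw [hD, hN]
    linear_combination Real.cos σ * hsc
  have hs : Real.sin (windAngle κ σ) * R = κ * Real.sin σ := by
    rw [hw, Real.sin_add, Real.cos_arctan, Real.sin_arctan, hr]
    field_simp
    rw [hD, hN]
    linear_combination κ * Real.sin σ * hsc
  rw [← Complex.ofReal_mul, ← hs, ← hc, Complex.exp_mul_I]
  push_cast
  ring

theorem monotone_delay {κ : ℝ} (h1 : 1 ≤ κ) (h2 : κ ^ 2 ≤ 2) : Monotone (delay κ) := by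
  have hκ : 0 < κ := by linarith
  have hd : ∀ σ, HasDerivAt (delay κ)
      (κ / (Real.cos σ ^ 2 + κ ^ 2 * Real.sin σ ^ 2) - κ / 2) σ := by
    intro σ
    refine (hasDerivAt_windAngle hκ σ).sub ?_
    simpa using ((hasDerivAt_id σ).const_mul κ).div_const 2
  refine monotone_of_deriv_nonneg (fun σ => (hd σ).differentiableAt) fun σ => ?_
  rw [(hd σ).deriv, sub_nonneg]
  have hsc := Real.sin_sq_add_cos_sq σ
  have hs : Real.sin σ ^ 2 ≤ 1 := Real.sin_sq_le_one σ
  gcongr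
  · exact cos_sq_add_pos (pow_pos hκ 2) σ
  · nlinarith [sq_nonneg (Real.sin σ)]

theorem delay_zero (κ : ℝ) : delay κ 0 = 0 := by simp [delay, windAngle]

theorem delay_sqrt_two_pi_div_two : delay (√2) (Real.pi / 2) = minDelay := by
  simp [delay, windAngle, minDelay]; ring

theorem minDelay_bounds : 0.46007 < minDelay ∧ minDelay < 0.461 := by
  have h1 := Real.pi_gt_d6
  have h2 := Real.pi_lt_d6
  have h3 : √2 < 1.414214 := by rw [Real.sqrt_lt' (by norm_num)]; norm_num
  have h4 : 1.414213 < √2 := by rw [Real.lt_sqrt (by norm_num)]; norm_num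
  rw [minDelay]
  constructor <;> nlinarith

/-- The case of constant `ζ`: the difference of the two sides vanishes at `0` and `π / 2`, and its
derivative is `cos` times a decreasing function, so that it first increases and then decreases. -/
theorem minDelay_mul_sin_le_delay_sqrt_two {σ : ℝ} (h0 : 0 ≤ σ) (h1 : σ ≤ Real.pi / 2) :
    minDelay * Real.sin σ ≤ delay (√2) σ := by
  have h2 : √(2 : ℝ) ^ 2 = 2 := Real.sq_sqrt (by norm_num)
  have h2p : 0 < √(2 : ℝ) := by positivity
  set φ : ℝ → ℝ := fun t => √2 * Real.cos t / (2 * (1 + Real.sin t ^ 2)) with hφ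
  have hd : ∀ t, HasDerivAt (fun t => delay (√2) t - minDelay * Real.sin t)
      (Real.cos t * (φ t - minDelay)) t := by
    intro t
    have h := ((hasDerivAt_windAngle h2p t).sub
      (((hasDerivAt_id t).const_mul (√2)).div_const 2)).sub
      ((Real.hasDerivAt_sin t).const_mul minDelay)
    refine h.congr_deriv ?_
    have hsc := Real.sin_sq_add_cos_sq t
    have e : Real.cos t ^ 2 + √2 ^ 2 * Real.sin t ^ 2 = 1 + Real.sin t ^ 2 := by
      rw [h2]; linear_combination hsc
    have hp : (1 + Real.sin t ^ 2) ≠ 0 := by positivity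
    simp only [hφ, e]
    field_simp
    linear_combination -√2 * hsc
  have hanti : ∀ a b, 0 ≤ a → a ≤ b → b ≤ Real.pi / 2 → φ b ≤ φ a := by
    intro a b ha hab hb
    have hc : Real.cos b ≤ Real.cos a :=
      Real.cos_le_cos_of_nonneg_of_le_pi ha (by linarith [Real.pi_pos]) hab
    have hs : Real.sin a ≤ Real.sin b := Real.sin_le_sin_of_le_of_le_pi_div_two
      (by linarith [Real.pi_pos]) hb hab
    have hs0 : 0 ≤ Real.sin a :=
      Real.sin_nonneg_of_nonneg_of_le_pi ha (by linarith [Real.pi_pos])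
    have hc0 : 0 ≤ Real.cos a := Real.cos_nonneg_of_neg_pi_div_two_le_of_le
      (by linarith [Real.pi_pos]) (by linarith)
    simp only [hφ]
    gcongr
  rw [← sub_nonneg]
  rcases le_total minDelay (φ σ) with h | h
  · have hmono : MonotoneOn (fun t => delay (√2) t - minDelay * Real.sin t) (Set.Icc 0 σ) := by
      refine monotoneOn_of_deriv_nonneg (convex_Icc _ _)
        (fun t _ => (hd t).continuousAt.continuousWithinAt)
        (fun t _ => (hd t).differentiableAt.differentiableWithinAt) fun t ht => ?_
      rw [interior_Icc] at ht
      rw [(hd t).deriv]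
      exact mul_nonneg (Real.cos_nonneg_of_neg_pi_div_two_le_of_le
        (by linarith [ht.1, Real.pi_pos]) (by linarith [ht.2]))
        (sub_nonneg.2 (h.trans (hanti t σ ht.1.le ht.2.le h1)))
    have := hmono ⟨le_rfl, h0⟩ ⟨h0, le_rfl⟩ h0
    simpa [delay_zero] using this
  · have hmono : AntitoneOn (fun t => delay (√2) t - minDelay * Real.sin t)
        (Set.Icc σ (Real.pi / 2)) := by
      refine antitoneOn_of_deriv_nonpos (convex_Icc _ _)
        (fun t _ => (hd t).continuousAt.continuousWithinAt)
        (fun t _ => (hd t).differentiableAt.differentiableWithinAt) fun t ht => ?_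
      rw [interior_Icc] at ht
      rw [(hd t).deriv]
      exact mul_nonpos_of_nonneg_of_nonpos (Real.cos_nonneg_of_neg_pi_div_two_le_of_le
        (by linarith [ht.1, Real.pi_pos]) ht.2.le)
        (sub_nonpos.2 ((hanti σ t h0 ht.1.le ht.2.le).trans h))
    have := hmono ⟨le_rfl, h1⟩ ⟨h1, le_rfl⟩ h1
    simpa [delay_sqrt_two_pi_div_two] using this

/-- The difference of the two sides decreases in `κ`, which reduces the claim to `κ = √2`. -/
theorem minDelay_mul_sin_le_delay {κ σ : ℝ} (hκ1 : 1 ≤ κ) (hκ2 : κ ^ 2 ≤ 2) (h0 : 0 ≤ σ)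
    (h1 : σ ≤ Real.pi / 2) : minDelay * (√(κ ^ 2 - 1) * Real.sin σ) ≤ delay κ σ := by
  have h2 : √(2 : ℝ) ^ 2 = 2 := Real.sq_sqrt (by norm_num)
  have hle : κ ≤ √2 := Real.le_sqrt_of_sq_le hκ2
  have hm := minDelay_bounds.1
  have hs0 : 0 ≤ Real.sin σ := Real.sin_nonneg_of_nonneg_of_le_pi h0 (by linarith [Real.pi_pos])
  have hd : ∀ k, 1 < k → HasDerivAt (fun k => delay k σ - minDelay * (√(k ^ 2 - 1) * Real.sin σ))
      (Real.sin σ * Real.cos σ / (Real.cos σ ^ 2 + k ^ 2 * Real.sin σ ^ 2) - σ / 2 -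
        minDelay * (k / √(k ^ 2 - 1) * Real.sin σ)) k := by
    intro k hk
    have hk2 : k ^ 2 - 1 ≠ 0 := by nlinarith
    have h := ((hasDerivAt_windAngle_left (by linarith : 0 < k) σ).sub
      (((hasDerivAt_id k).mul_const σ).div_const 2)).sub
      (((((hasDerivAt_pow 2 k).sub_const 1).sqrt hk2).mul_const (Real.sin σ)).const_mul minDelay)
    refine h.congr_deriv ?_
    simp
    left; left; field_simp
  have hc : Continuous fun k => √(k ^ 2 - 1) := by fun_prop
  have hanti : AntitoneOn (fun k => delay k σ - minDelay * (√(k ^ 2 - 1) * Real.sin σ))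
      (Set.Icc 1 √2) := by
    refine antitoneOn_of_deriv_nonpos (convex_Icc _ _) ?_ ?_ ?_
    · intro k hk
      refine ContinuousAt.continuousWithinAt ?_
      have hk0 : 0 < k := by linarith [hk.1]
      have := (hasDerivAt_windAngle_left hk0 σ).continuousAt
      unfold delay
      fun_prop
    · intro k hk
      rw [interior_Icc] at hk
      exact (hd k hk.1).differentiableAt.differentiableWithinAt
    · intro k hk
      rw [interior_Icc] at hk
      rw [(hd k hk.1).deriv]
      have hk0 : 0 < k := by linarith [hk.1]
      have hk2 : k ^ 2 ≤ 2 := by rw [← h2]; gcongr; exact hk.2.le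
      have hr : 0 < √(k ^ 2 - 1) := Real.sqrt_pos.2 (by nlinarith [hk.1])
      have h3 : 1.2 ≤ k / √(k ^ 2 - 1) := by
        rw [le_div_iff₀ hr, ← le_div_iff₀' (by norm_num)]
        refine Real.sqrt_le_iff.2 ⟨by positivity, ?_⟩
        rw [div_pow, le_div_iff₀ (by norm_num)]
        linarith
      have h4 : Real.sin σ * Real.cos σ / (Real.cos σ ^ 2 + k ^ 2 * Real.sin σ ^ 2) ≤
          Real.sin σ := by
        rw [div_le_iff₀ (cos_sq_add_pos (pow_pos hk0 2) σ)]
        have hsc := Real.sin_sq_add_cos_sq σ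
        have : (1 : ℝ) ≤ Real.cos σ ^ 2 + k ^ 2 * Real.sin σ ^ 2 := by
          have hk1 : 1 ≤ k ^ 2 := one_le_pow₀ hk.1.le
          nlinarith [mul_nonneg (sub_nonneg.2 hk1) (sq_nonneg (Real.sin σ))]
        exact mul_le_mul_of_nonneg_left ((Real.cos_le_one σ).trans this) hs0
      have h5 := Real.sin_le h0
      have h6 : 0.5 * Real.sin σ ≤ minDelay * (k / √(k ^ 2 - 1) * Real.sin σ) := by
        rw [← mul_assoc]
        gcongr
        nlinarith
      linarith
  have h := hanti ⟨hκ1, hle⟩ ⟨hκ1.trans hle, le_rfl⟩ hle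
  have h3 := minDelay_mul_sin_le_delay_sqrt_two h0 h1
  simp only [h2] at h
  norm_num at h
  linarith

/-- Beyond a half turn the delay keeps growing while the chord `√(κ² - 1) |sin σ|` stays bounded
by its value at `π / 2`. -/
theorem minDelay_mul_abs_le_delay {κ σ : ℝ} (hκ1 : 1 ≤ κ) (hκ2 : κ ^ 2 ≤ 2) (h0 : 0 ≤ σ) :
    minDelay * (√(κ ^ 2 - 1) * |Real.sin σ|) ≤ delay κ σ := by
  have hm : 0 < minDelay := by linarith [minDelay_bounds.1]
  rcases le_total σ (Real.pi / 2) with h | h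
  · rw [abs_of_nonneg (Real.sin_nonneg_of_nonneg_of_le_pi h0 (by linarith [Real.pi_pos]))]
    exact minDelay_mul_sin_le_delay hκ1 hκ2 h0 h
  · refine le_trans ?_ (monotone_delay hκ1 hκ2 h)
    refine le_trans ?_ (minDelay_mul_sin_le_delay hκ1 hκ2 (by positivity) le_rfl)
    rw [Real.sin_pi_div_two]
    gcongr
    exact Real.abs_sin_le_one σ

theorem delay_pos {κ σ : ℝ} (hκ1 : 1 ≤ κ) (hκ2 : κ ^ 2 ≤ 2) (h0 : 0 < σ) : 0 < delay κ σ := by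
  have hm : 0 < minDelay := by linarith [minDelay_bounds.1]
  rcases hκ1.eq_or_lt with rfl | h
  · simp [delay, windAngle]; linarith
  · have hr : 0 < √(κ ^ 2 - 1) := Real.sqrt_pos.2 (by nlinarith)
    have hmin : 0 < min σ 1 := lt_min h0 one_pos
    refine lt_of_lt_of_le ?_ (monotone_delay hκ1 hκ2 (min_le_left σ 1))
    refine lt_of_lt_of_le ?_ (minDelay_mul_sin_le_delay hκ1 hκ2 hmin.le
      ((min_le_right σ 1).trans Real.one_le_pi_div_two))
    have := Real.sin_pos_of_pos_of_le_one hmin (min_le_right σ 1)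
    positivity

/-! ### Solution of the linear system -/

section

open Complex ComplexConjugate

theorem eqOn_const_of_hasDerivWithinAt_zero {F : Type*} [NormedAddCommGroup F] [NormedSpace ℝ F]
    {f : ℝ → F} {a b : ℝ} (hf : ∀ s ∈ Set.Icc a b, HasDerivWithinAt f 0 (Set.Icc a b) s)
    {s : ℝ} (hs : s ∈ Set.Icc a b) : f s = f a := by
  have h := (convex_Icc a b).norm_image_sub_le_of_norm_hasDerivWithin_le (C := 0) hf (by simp)
    (Set.left_mem_Icc.2 (hs.1.trans hs.2)) hs
  simpa [sub_eq_zero] using h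

/-- The linear system `f' = -i e f + V conj g`, `g' = -i e g + V conj f` with `V` rotating at
speed `2 e` is solved by rotating coordinates, after which it is an oscillator of frequency `Ω`.
Two first integrals of the oscillator determine the solution. -/
theorem spinor_solution {f g V : ℝ → ℂ} {a b e Ω : ℝ} (hab : a ≤ b) (hΩ : 0 < Ω)
    (hf : ∀ s ∈ Set.Icc a b, HasDerivWithinAt f (-e * I * f s + V s * conj (g s)) (Set.Icc a b) s)
    (hg : ∀ s ∈ Set.Icc a b, HasDerivWithinAt g (-e * I * g s + V s * conj (f s)) (Set.Icc a b) s)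
    (hV : ∀ s ∈ Set.Icc a b, HasDerivWithinAt V (2 * e * I * V s) (Set.Icc a b) s)
    (hΩV : Ω ^ 2 = 4 * e ^ 2 - normSq (V a)) {s : ℝ} (hs : s ∈ Set.Icc a b) :
    f s = cexp (e * (s - a) * I) *
      ((Real.cos (Ω * (s - a)) - 2 * e / Ω * Real.sin (Ω * (s - a)) * I) * f a +
        V a / Ω * Real.sin (Ω * (s - a)) * conj (g a)) := by
  set J := Set.Icc a b with hJ
  have hmem : a ∈ J := Set.left_mem_Icc.2 hab
  have hexp : ∀ c : ℝ, ∀ t : ℝ, HasDerivWithinAt (fun t : ℝ => cexp (c * (t - a) * I))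
      (c * I * cexp (c * (t - a) * I)) J t := by
    intro c t
    have h1 : HasDerivAt (fun t : ℝ => (c * (t - a) * I : ℂ)) (c * I) t := by
      have := ((((hasDerivAt_id t).sub_const a).const_mul c).ofReal_comp).mul_const I
      simpa using this
    refine (h1.cexp.congr_deriv ?_).hasDerivWithinAt
    ring
  have hcos : ∀ t : ℝ, HasDerivWithinAt (fun t : ℝ => (Real.cos (Ω * (t - a)) : ℂ))
      (-(Ω * Real.sin (Ω * (t - a)))) J t := by
    intro t
    have h1 : HasDerivAt (fun t : ℝ => Ω * (t - a)) Ω t := by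
      simpa using ((hasDerivAt_id t).sub_const a).const_mul Ω
    refine (h1.cos.ofReal_comp.congr_deriv ?_).hasDerivWithinAt
    push_cast; ring
  have hsin : ∀ t : ℝ, HasDerivWithinAt (fun t : ℝ => (Real.sin (Ω * (t - a)) : ℂ))
      (Ω * Real.cos (Ω * (t - a))) J t := by
    intro t
    have h1 : HasDerivAt (fun t : ℝ => Ω * (t - a)) Ω t := by
      simpa using ((hasDerivAt_id t).sub_const a).const_mul Ω
    refine (h1.sin.ofReal_comp.congr_deriv ?_).hasDerivWithinAt
    push_cast; ring
  have hexpmul : ∀ c : ℝ, ∀ t : ℝ, cexp (c * (t - a) * I) * cexp ((-c : ℝ) * (t - a) * I) = 1 := by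
    intro c t
    rw [← exp_add, ofReal_neg]; ring_nf; simp
  -- the velocity rotates uniformly
  have hVsol : ∀ t ∈ J, V t = cexp ((2 * e : ℝ) * (t - a) * I) * V a := by
    intro t ht
    have h := eqOn_const_of_hasDerivWithinAt_zero
      (f := fun t => cexp ((-(2 * e) : ℝ) * (t - a) * I) * V t) (a := a) (b := b)
      (fun t ht => ((hexp (-(2 * e)) t).mul (hV t ht)).congr_deriv (by push_cast; ring)) ht
    have h1 : cexp ((-(2 * e) : ℝ) * (t - a) * I) * V t = V a := by simpa using h
    rw [← h1, ← mul_assoc, hexpmul, one_mul]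
  set X : ℝ → ℂ := fun t => cexp ((-e : ℝ) * (t - a) * I) * f t with hX
  set Y : ℝ → ℂ := fun t => cexp ((e : ℝ) * (t - a) * I) * conj (g t) with hY
  have hgc : ∀ t ∈ J, HasDerivWithinAt (fun t => conj (g t))
      (e * I * conj (g t) + conj (V t) * f t) J t := by
    intro t ht
    have := (hg t ht).star
    refine this.congr_deriv ?_
    simp
  have hXd : ∀ t ∈ J, HasDerivWithinAt X (-(2 * e) * I * X t + V a * Y t) J t := by
    intro t ht
    refine ((hexp (-e) t).mul (hf t ht)).congr_deriv ?_
    have h2 : cexp ((-e : ℝ) * (t - a) * I) * cexp ((2 * e : ℝ) * (t - a) * I) =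
        cexp ((e : ℝ) * (t - a) * I) := by
      rw [← exp_add]; push_cast; ring_nf
    rw [hVsol t ht]
    simp only [hX, hY]
    push_cast at h2 ⊢
    linear_combination V a * conj (g t) * h2
  have hYd : ∀ t ∈ J, HasDerivWithinAt Y ((2 * e) * I * Y t + conj (V a) * X t) J t := by
    intro t ht
    refine ((hexp e t).mul (hgc t ht)).congr_deriv ?_
    have h2 : cexp ((e : ℝ) * (t - a) * I) * conj (cexp ((2 * e : ℝ) * (t - a) * I)) =
        cexp ((-e : ℝ) * (t - a) * I) := by
      rw [← exp_conj, ← exp_add]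
      simp only [map_mul, map_sub, conj_ofReal, conj_I]
      push_cast; ring_nf
    rw [hVsol t ht, map_mul]
    simp only [hX, hY]
    push_cast at h2 ⊢
    linear_combination f t * conj (V a) * h2
  have hΩc : (Ω : ℂ) ≠ 0 := by exact_mod_cast hΩ.ne'
  have hΩV' : (Ω : ℂ) ^ 2 = 4 * e ^ 2 - V a * conj (V a) := by
    rw [mul_conj]; exact_mod_cast hΩV
  have hI : I ^ 2 = -1 := I_sq
  have h1 := eqOn_const_of_hasDerivWithinAt_zero
    (f := fun t => (Real.cos (Ω * (t - a)) : ℂ) * X t -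
      (Real.sin (Ω * (t - a)) : ℂ) * (-(2 * e) * I * X t + V a * Y t) / Ω) (a := a) (b := b)
    (fun t ht => by
      have hXt := hXd t ht
      have hYt := hYd t ht
      refine (((hcos t).mul hXt).sub (((hsin t).mul ((hXt.const_mul (-(2 * e) * I : ℂ)).add
        (hYt.const_mul (V a)))).div_const (Ω : ℂ))).congr_deriv ?_
      simp only [Pi.add_apply]
      field_simp
      linear_combination (-(Real.sin (Ω * (t - a)) : ℂ) * X t) * (hΩV' + 4 * e ^ 2 * hI)) hs
  have h2 := eqOn_const_of_hasDerivWithinAt_zero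
    (f := fun t => (Real.sin (Ω * (t - a)) : ℂ) * X t +
      (Real.cos (Ω * (t - a)) : ℂ) * (-(2 * e) * I * X t + V a * Y t) / Ω) (a := a) (b := b)
    (fun t ht => by
      have hXt := hXd t ht
      have hYt := hYd t ht
      refine (((hsin t).mul hXt).add (((hcos t).mul ((hXt.const_mul (-(2 * e) * I : ℂ)).add
        (hYt.const_mul (V a)))).div_const (Ω : ℂ))).congr_deriv ?_
      simp only [Pi.add_apply]
      field_simp
      linear_combination ((Real.cos (Ω * (t - a)) : ℂ) * X t) * (hΩV' + 4 * e ^ 2 * hI)) hs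
  have hXa : X a = f a := by simp [hX]
  have hYa : Y a = conj (g a) := by simp [hY]
  simp only [sub_self, mul_zero, Real.cos_zero, Real.sin_zero, ofReal_one, ofReal_zero, one_mul,
    zero_mul, zero_div, sub_zero, zero_add, hXa, hYa] at h1 h2
  have hsc : (Real.sin (Ω * (s - a)) : ℂ) ^ 2 + (Real.cos (Ω * (s - a)) : ℂ) ^ 2 = 1 := by
    exact_mod_cast Real.sin_sq_add_cos_sq (Ω * (s - a))
  have hfin : X s = (Real.cos (Ω * (s - a)) : ℂ) * f a +
      Real.sin (Ω * (s - a)) * ((-(2 * e) * I * f a + V a * conj (g a)) / Ω) := by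
    linear_combination (Real.cos (Ω * (s - a)) : ℂ) * h1 + (Real.sin (Ω * (s - a)) : ℂ) * h2 -
      X s * hsc
  have h3 : f s = cexp (e * (s - a) * I) * X s := by
    rw [hX, ← mul_assoc, hexpmul, one_mul]
  rw [h3, hfin]
  field_simp
  ring

end

/-! ### Amplitudes relative to a base event -/

section

open Complex ComplexConjugate

/-- `relA` without the phase of `p` (see `relA_eq`). Its real part is positive, so its argument is
a continuous function of `p`. -/
def relPlane (α : ℝ) (c p : Event) : ℂ :=
  stretch α p * stretch α c - plane α p * conj (plane α c)

/-- First entry of `p c⁻¹` in `SU(1, 1)`, up to the phase of `c`: the first amplitude of `p`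
relative to the base event `c`. Its modulus is the hyperbolic cosine of half the hyperbolic
distance between the fluid lines of `c` and `p`. -/
def relA (α : ℝ) (c p : Event) : ℂ := ampA α p * stretch α c - ampB α p * conj (plane α c)

/-- Second entry of `p c⁻¹` in `SU(1, 1)`, up to the phase of `c`. Its modulus is the hyperbolic
sine of half the hyperbolic distance between the fluid lines of `c` and `p`. -/
def relB (α : ℝ) (c p : Event) : ℂ := ampB α p * stretch α c - ampA α p * plane α c

/-- The argument of `relA`, lifted to a real number that depends continuously on `p`. It plays the
role of a (reversed) time coordinate relative to `c`, and unlike `relA` it detects `τ` itself. -/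
def relAngle (α : ℝ) (c p : Event) : ℝ := -(rate α * p 0) + arg (relPlane α c p)

theorem norm_plane_lt (α : ℝ) (p : Event) : ‖plane α p‖ < stretch α p := by
  refine lt_of_pow_lt_pow_left₀ 2 (stretch_pos α p).le ?_
  rw [← normSq_eq_norm_sq, normSq_plane]; linarith

theorem relPlane_re_pos (α : ℝ) (c p : Event) : 0 < (relPlane α c p).re := by
  have h1 := norm_plane_lt α p
  have h2 := norm_plane_lt α c
  have h3 : (plane α p * conj (plane α c)).re ≤ ‖plane α p‖ * ‖plane α c‖ := by
    refine (re_le_norm _).trans ?_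
    rw [norm_mul, norm_conj]
  have h4 : ‖plane α p‖ * ‖plane α c‖ < stretch α p * stretch α c :=
    mul_lt_mul'' h1 h2 (norm_nonneg _) (norm_nonneg _)
  rw [relPlane, sub_re, ← ofReal_mul, ofReal_re]
  linarith

theorem relA_eq (α : ℝ) (c p : Event) : relA α c p = relPlane α c p * phase α p := by
  simp only [relA, relPlane, ampA, ampB]; ring

theorem norm_phase (α : ℝ) (p : Event) : ‖phase α p‖ = 1 := by
  rw [phase, ← ofReal_neg, norm_exp_ofReal_mul_I]

theorem relA_polar (α : ℝ) (c p : Event) :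
    relA α c p = ‖relA α c p‖ * cexp (relAngle α c p * I) := by
  have h := norm_mul_exp_arg_mul_I (relPlane α c p)
  rw [relA_eq, norm_mul, norm_phase, mul_one, relAngle, ofReal_add, add_mul, exp_add, phase]
  conv_lhs => rw [← h]
  push_cast; ring

theorem relA_mul_conj (α : ℝ) (c p : Event) :
    relA α c p * conj (relA α c p) - relB α c p * conj (relB α c p) = 1 := by
  have h1 := ampA_mul_conj α p
  have h2 : plane α c * conj (plane α c) = (stretch α c : ℂ) ^ 2 - 1 := by
    rw [mul_conj, normSq_plane]; push_cast; ring
  simp only [relA, relB, map_sub, map_mul, conj_ofReal, conj_conj]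
  linear_combination ((stretch α c : ℂ) ^ 2 - plane α c * conj (plane α c)) * h1 - h2

theorem norm_relB_sq (α : ℝ) (c p : Event) : ‖relB α c p‖ ^ 2 = ‖relA α c p‖ ^ 2 - 1 := by
  have h := relA_mul_conj α c p
  rw [mul_conj, mul_conj, normSq_eq_norm_sq, normSq_eq_norm_sq] at h
  have : ‖relA α c p‖ ^ 2 - ‖relB α c p‖ ^ 2 = 1 := by exact_mod_cast h
  linarith

theorem one_le_norm_relA (α : ℝ) (c p : Event) : 1 ≤ ‖relA α c p‖ := by
  have h := norm_relB_sq α c p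
  nlinarith [sq_nonneg ‖relB α c p‖, norm_nonneg (relA α c p)]

theorem relA_ne_zero (α : ℝ) (c p : Event) : relA α c p ≠ 0 :=
  norm_pos_iff.1 (by linarith [one_le_norm_relA α c p])

theorem relB_self (α : ℝ) (c : Event) : relB α c c = 0 := by
  simp only [relB, ampA, ampB]; ring

theorem norm_relA_self (α : ℝ) (c : Event) : ‖relA α c c‖ = 1 := by
  have h := norm_relB_sq α c c
  rw [relB_self] at h
  have h1 := norm_nonneg (relA α c c)
  norm_num at h
  nlinarith

/-- A continuous real function with values in `2πℤ` that starts at `0` vanishes. -/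
theorem eq_zero_of_exp_eq_one {f : ℝ → ℝ} {a b : ℝ} (hf : ContinuousOn f (Set.Icc a b))
    (h0 : f a = 0) (h1 : ∀ s ∈ Set.Icc a b, cexp (f s * I) = 1) {s : ℝ}
    (hs : s ∈ Set.Icc a b) : f s = 0 := by
  have hcos : ∀ s ∈ Set.Icc a b, Real.cos (f s) = 1 := fun s hs => by
    have := congrArg re (h1 s hs)
    rwa [exp_ofReal_mul_I_re, one_re] at this
  have hf' : ContinuousOn f (Set.Icc a s) := hf.mono (Set.Icc_subset_Icc_right hs.2)
  have hpi := Real.pi_pos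
  obtain ⟨n, hn⟩ := (Real.cos_eq_one_iff _).1 (hcos s hs)
  rcases lt_trichotomy n 0 with h | h | h
  · exfalso
    have hle : (n : ℝ) ≤ -1 := by exact_mod_cast Int.le_sub_one_of_lt h
    obtain ⟨t, ht, hft⟩ := intermediate_value_Icc' hs.1 hf'
      (show -Real.pi ∈ Set.Icc (f s) (f a) from ⟨by nlinarith, by linarith⟩)
    have := hcos t ⟨ht.1, ht.2.trans hs.2⟩
    rw [hft, Real.cos_neg, Real.cos_pi] at this
    norm_num at this
  · rw [← hn, h]; simp
  · exfalso
    have hle : (1 : ℝ) ≤ n := by exact_mod_cast h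
    obtain ⟨t, ht, hft⟩ := intermediate_value_Icc hs.1 hf'
      (show Real.pi ∈ Set.Icc (f a) (f s) from ⟨by linarith, by nlinarith⟩)
    have := hcos t ⟨ht.1, ht.2.trans hs.2⟩
    rw [hft, Real.cos_pi] at this
    norm_num at this

section

variable {α : ℝ} {γ v : ℝ → Event} {a b : ℝ}

theorem IsGeodesicOn.energy_eq (h : IsGeodesicOn α γ v (Set.Icc a b)) {s : ℝ}
    (hs : s ∈ Set.Icc a b) : energy α (γ s) (v s) = energy α (γ a) (v a) :=
  eqOn_const_of_hasDerivWithinAt_zero (f := fun s => energy α (γ s) (v s))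
    (fun _ ht => h.hasDerivWithinAt_energy ht) hs

/-- Passing to a base event is right translation in `SU(1, 1)`, which preserves the linear system
for the amplitudes. -/
theorem IsGeodesicOn.rel_solution (h : IsGeodesicOn α γ v (Set.Icc a b)) (hab : a ≤ b) {Ω e : ℝ}
    (he : e = rate α * energy α (γ a) (v a)) (hΩ : 0 < Ω)
    (hΩV : Ω ^ 2 = 4 * e ^ 2 - normSq (ampV α (γ a) (v a))) (c : Event) {s : ℝ}
    (hs : s ∈ Set.Icc a b) :
    relA α c (γ s) = cexp (e * (s - a) * I) *
      ((Real.cos (Ω * (s - a)) - 2 * e / Ω * Real.sin (Ω * (s - a)) * I) * relA α c (γ a) +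
        ampV α (γ a) (v a) / Ω * Real.sin (Ω * (s - a)) * conj (relB α c (γ a))) ∧
    relB α c (γ s) = cexp (e * (s - a) * I) *
      ((Real.cos (Ω * (s - a)) - 2 * e / Ω * Real.sin (Ω * (s - a)) * I) * relB α c (γ a) +
        ampV α (γ a) (v a) / Ω * Real.sin (Ω * (s - a)) * conj (relA α c (γ a))) := by
  have hA : ∀ t ∈ Set.Icc a b, HasDerivWithinAt (fun t => relA α c (γ t))
      (-e * I * relA α c (γ t) + ampV α (γ t) (v t) * conj (relB α c (γ t))) (Set.Icc a b) t := by
    intro t ht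
    have h1 := ((hasDerivWithinAt_ampA (α := α) (h t ht).1).mul_const (stretch α c : ℂ)).sub
      ((hasDerivWithinAt_ampB (α := α) (h t ht).1).mul_const (conj (plane α c)))
    refine h1.congr_deriv ?_
    rw [h.energy_eq ht, ← he]
    simp only [relA, relB, map_sub, map_mul, conj_ofReal]
    ring
  have hB : ∀ t ∈ Set.Icc a b, HasDerivWithinAt (fun t => relB α c (γ t))
      (-e * I * relB α c (γ t) + ampV α (γ t) (v t) * conj (relA α c (γ t))) (Set.Icc a b) t := by
    intro t ht
    have h1 := ((hasDerivWithinAt_ampB (α := α) (h t ht).1).mul_const (stretch α c : ℂ)).sub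
      ((hasDerivWithinAt_ampA (α := α) (h t ht).1).mul_const (plane α c))
    refine h1.congr_deriv ?_
    rw [h.energy_eq ht, ← he]
    simp only [relA, relB, map_sub, map_mul, conj_ofReal, conj_conj]
    ring
  have hV : ∀ t ∈ Set.Icc a b, HasDerivWithinAt (fun t => ampV α (γ t) (v t))
      (2 * e * I * ampV α (γ t) (v t)) (Set.Icc a b) t := by
    intro t ht
    refine (h.hasDerivWithinAt_ampV ht).congr_deriv ?_
    rw [h.energy_eq ht, mul_assoc 2, ← he]; push_cast; ring
  exact ⟨spinor_solution hab hΩ hA hB hV hΩV hs, spinor_solution hab hΩ hB hA hV hΩV hs⟩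

/-- The relative amplitude of two points of one geodesic does not depend on `c`. Its argument is
minus the delay. -/
theorem IsGeodesicOn.rel_mul_conj (h : IsGeodesicOn α γ v (Set.Icc a b)) (hab : a ≤ b) {Ω e κ : ℝ}
    (he : e = rate α * energy α (γ a) (v a)) (hΩ : 0 < Ω)
    (hΩV : Ω ^ 2 = 4 * e ^ 2 - normSq (ampV α (γ a) (v a))) (hκ : 0 < κ) (hκe : κ * Ω = 2 * e)
    (c : Event) {s : ℝ} (hs : s ∈ Set.Icc a b) :
    relA α c (γ s) * conj (relA α c (γ a)) - relB α c (γ s) * conj (relB α c (γ a)) =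
      (√(Real.cos (Ω * (s - a)) ^ 2 + κ ^ 2 * Real.sin (Ω * (s - a)) ^ 2) : ℝ) *
        cexp (-delay κ (Ω * (s - a)) * I) := by
  obtain ⟨h1, h2⟩ := h.rel_solution hab he hΩ hΩV c hs
  have h3 := exp_windAngle hκ (Ω * (s - a))
  have h4 := congrArg conj h3
  rw [map_add, map_mul, map_mul, map_mul, conj_ofReal, conj_ofReal, conj_ofReal, conj_ofReal,
    conj_I, ← exp_conj, map_mul, conj_ofReal, conj_I] at h4
  have h5 : (2 * e / Ω : ℂ) = κ := by
    rw [div_eq_iff (by exact_mod_cast hΩ.ne')]; exact_mod_cast hκe.symm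
  have h6 := relA_mul_conj α c (γ a)
  have h7 : cexp (-delay κ (Ω * (s - a)) * I) =
      cexp (e * (s - a) * I) * cexp (windAngle κ (Ω * (s - a)) * -I) := by
    rw [← exp_add, delay]
    congr 1
    push_cast
    have : (κ : ℂ) * Ω = 2 * e := by exact_mod_cast hκe
    linear_combination (s - a) / 2 * I * this
  rw [h7, h1, h2, h5]
  linear_combination cexp (e * (s - a) * I) * h4 + cexp (e * (s - a) * I) *
    ((Real.cos (Ω * (s - a)) : ℂ) - κ * Real.sin (Ω * (s - a)) * I) * h6

theorem continuousOn_relAngle (h : IsGeodesicOn α γ v (Set.Icc a b)) (c : Event) :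
    ContinuousOn (fun s => relAngle α c (γ s)) (Set.Icc a b) := by
  have h0 : ContinuousOn γ (Set.Icc a b) := fun s hs => (h s hs).1.continuousWithinAt
  have h1 : ContinuousOn (fun s => relPlane α c (γ s)) (Set.Icc a b) := by
    intro s hs
    have h2 := (hasDerivWithinAt_stretch (α := α) (h s hs).1).ofReal_comp.continuousWithinAt
    have h3 := (hasDerivWithinAt_plane (α := α) (h s hs).1).continuousWithinAt
    exact (h2.mul_const _).sub (h3.mul_const _)
  have h4 : ContinuousOn (fun s => γ s 0) (Set.Icc a b) := continuousOn_pi.1 h0 0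
  refine (continuousOn_const.mul h4).neg.add fun s hs => ?_
  exact ContinuousAt.comp_continuousWithinAt (g := arg) (f := fun s => relPlane α c (γ s))
    (continuousAt_arg (Or.inl (relPlane_re_pos α c (γ s)))) (h1 s hs)

/-- Half the signed area of the hyperbolic geodesic triangle formed by the fluid lines of `c`, `p`
and `q`; the two quotients are the points of the Poincaré disc centred at `c`. -/
def turn (α : ℝ) (c p q : Event) : ℝ :=
  -arg (1 - relB α c q / relA α c q * conj (relB α c p / relA α c p))

theorem norm_relB_div_lt (α : ℝ) (c p : Event) : ‖relB α c p / relA α c p‖ < 1 := by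
  rw [norm_div, div_lt_one (norm_pos_iff.2 (relA_ne_zero α c p))]
  refine lt_of_pow_lt_pow_left₀ 2 (norm_nonneg _) ?_
  rw [norm_relB_sq]; linarith

theorem one_sub_re_pos (α : ℝ) (c p q : Event) :
    0 < (1 - relB α c q / relA α c q * conj (relB α c p / relA α c p)).re := by
  have h1 := norm_relB_div_lt α c p
  have h2 := norm_relB_div_lt α c q
  have h3 := re_le_norm (relB α c q / relA α c q * conj (relB α c p / relA α c p))
  rw [norm_mul, norm_conj] at h3
  have h4 : ‖relB α c q / relA α c q‖ * ‖relB α c p / relA α c p‖ < 1 :=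
    mul_lt_one_of_nonneg_of_lt_one_left (norm_nonneg _) h2 h1.le
  rw [sub_re, one_re]
  linarith

theorem turn_self (α : ℝ) (c p : Event) : turn α c p p = 0 := by
  have h := norm_relB_div_lt α c p
  have h0 := norm_nonneg (relB α c p / relA α c p)
  rw [turn, mul_conj, normSq_eq_norm_sq, ← ofReal_one, ← ofReal_sub, arg_ofReal_of_nonneg, neg_zero]
  nlinarith

theorem continuousOn_turn (h : IsGeodesicOn α γ v (Set.Icc a b)) (c p : Event) :
    ContinuousOn (fun s => turn α c p (γ s)) (Set.Icc a b) := by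
  intro s hs
  have hA := (hasDerivWithinAt_ampA (α := α) (h s hs).1).continuousWithinAt
  have hB := (hasDerivWithinAt_ampB (α := α) (h s hs).1).continuousWithinAt
  have hrA : ContinuousWithinAt (fun t => relA α c (γ t)) (Set.Icc a b) s :=
    (hA.mul_const _).sub (hB.mul_const _)
  have hrB : ContinuousWithinAt (fun t => relB α c (γ t)) (Set.Icc a b) s :=
    (hB.mul_const _).sub (hA.mul_const _)
  have h1 : ContinuousWithinAt (fun t => 1 - relB α c (γ t) / relA α c (γ t) *
      conj (relB α c p / relA α c p)) (Set.Icc a b) s :=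
    continuousWithinAt_const.sub ((hrB.div hrA (relA_ne_zero α c _)).mul_const _)
  exact (ContinuousAt.comp_continuousWithinAt (g := arg) (f := fun t =>
    1 - relB α c (γ t) / relA α c (γ t) * conj (relB α c p / relA α c p)) (continuousAt_arg
    (Or.inl (one_sub_re_pos α c p (γ s)))) h1).neg

/-- Polar form of the relative amplitude of `p` and `q`. -/
theorem relA_mul_conj_sub (α : ℝ) (c p q : Event) :
    relA α c q * conj (relA α c p) - relB α c q * conj (relB α c p) =
      (‖relA α c q‖ * ‖relA α c p‖ *
        ‖1 - relB α c q / relA α c q * conj (relB α c p / relA α c p)‖ : ℝ) *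
        cexp ((relAngle α c q - relAngle α c p - turn α c p q : ℝ) * I) := by
  have h1 := relA_polar α c q
  have h2 := congrArg conj (relA_polar α c p)
  have h3 := norm_mul_exp_arg_mul_I
    (1 - relB α c q / relA α c q * conj (relB α c p / relA α c p))
  have h4 : relA α c q * conj (relA α c p) - relB α c q * conj (relB α c p) =
      relA α c q * conj (relA α c p) *
        (1 - relB α c q / relA α c q * conj (relB α c p / relA α c p)) := by
    have ha := relA_ne_zero α c q
    have hb : conj (relA α c p) ≠ 0 := (map_ne_zero _).2 (relA_ne_zero α c p)
    rw [map_div₀]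
    field_simp
  rw [map_mul, conj_ofReal, ← exp_conj, map_mul, conj_ofReal, conj_I] at h2
  have e : cexp ((relAngle α c q - relAngle α c p - turn α c p q : ℝ) * I) =
      cexp (relAngle α c q * I) * cexp (relAngle α c p * -I) *
        cexp (arg (1 - relB α c q / relA α c q * conj (relB α c p / relA α c p)) * I) := by
    rw [← exp_add, ← exp_add, turn]; congr 1; push_cast; ring
  rw [h4, e]
  push_cast
  linear_combination (conj (relA α c p) *
      (1 - relB α c q / relA α c q * conj (relB α c p / relA α c p))) * h1 +
    (‖relA α c q‖ * cexp (relAngle α c q * I) *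
      (1 - relB α c q / relA α c q * conj (relB α c p / relA α c p))) * h2 -
    (‖relA α c q‖ * cexp (relAngle α c q * I) * (‖relA α c p‖ * cexp (relAngle α c p * -I))) * h3

/-- The angular balance along a geodesic. Modulo `2π` it compares the arguments in `rel_mul_conj`
and `relA_mul_conj_sub`; continuity along the geodesic fixes the multiple of `2π`. -/
theorem IsGeodesicOn.relAngle_sub (h : IsGeodesicOn α γ v (Set.Icc a b)) (hab : a ≤ b)
    {Ω e κ : ℝ} (he : e = rate α * energy α (γ a) (v a)) (hΩ : 0 < Ω)
    (hΩV : Ω ^ 2 = 4 * e ^ 2 - normSq (ampV α (γ a) (v a))) (hκ : 0 < κ) (hκe : κ * Ω = 2 * e)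
    (c : Event) {s : ℝ} (hs : s ∈ Set.Icc a b) :
    relAngle α c (γ s) - relAngle α c (γ a) =
      turn α c (γ a) (γ s) - delay κ (Ω * (s - a)) := by
  rw [← sub_eq_zero]
  refine eq_zero_of_exp_eq_one (f := fun s => relAngle α c (γ s) - relAngle α c (γ a) -
    (turn α c (γ a) (γ s) - delay κ (Ω * (s - a)))) (a := a) (b := b) ?_ ?_ ?_ hs
  · refine ((continuousOn_relAngle h c).sub continuousOn_const).sub
      ((continuousOn_turn h c _).sub (Continuous.continuousOn ?_))
    have : Continuous (windAngle κ) :=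
      continuous_iff_continuousAt.2 fun σ => (hasDerivAt_windAngle hκ σ).continuousAt
    unfold delay
    fun_prop
  · simp [turn_self, delay_zero]
  · intro t ht
    have h1 := h.rel_mul_conj hab he hΩ hΩV hκ hκe c ht
    rw [relA_mul_conj_sub] at h1
    set R := √(Real.cos (Ω * (t - a)) ^ 2 + κ ^ 2 * Real.sin (Ω * (t - a)) ^ 2)
    set M := ‖relA α c (γ t)‖ * ‖relA α c (γ a)‖ *
      ‖1 - relB α c (γ t) / relA α c (γ t) * conj (relB α c (γ a) / relA α c (γ a))‖
    have hM : 0 < M := by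
      have h2 := norm_pos_iff.2 (relA_ne_zero α c (γ t))
      have h3 := norm_pos_iff.2 (relA_ne_zero α c (γ a))
      have h4 := (one_sub_re_pos α c (γ a) (γ t)).trans_le (re_le_norm _)
      positivity
    have hRM : M = R := by
      have := congrArg norm h1
      rw [norm_mul, norm_mul, ← ofReal_neg, norm_exp_ofReal_mul_I, norm_exp_ofReal_mul_I,
        norm_real, norm_real, mul_one, mul_one, Real.norm_of_nonneg hM.le,
        Real.norm_of_nonneg (Real.sqrt_nonneg _)] at this
      exact this
    rw [← hRM] at h1
    have h5 := mul_left_cancel₀ (ofReal_ne_zero.2 hM.ne') h1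
    have h6 : cexp (-delay κ (Ω * (t - a)) * I) * cexp (delay κ (Ω * (t - a)) * I) = 1 := by
      rw [← exp_add]; simp
    rw [← h6, ← h5, ← exp_add]
    congr 1
    push_cast
    ring

end

end

/-! ### Turn and delay of a null segment -/

section

open Complex ComplexConjugate

theorem abs_turn_lt (α : ℝ) (c p q : Event) : |turn α c p q| < Real.pi / 2 := by
  rw [turn, abs_neg]
  exact abs_arg_lt_pi_div_two_iff.2 (Or.inl (one_sub_re_pos α c p q))

/-- The half-angle form of the law of cosines: `turn` is determined by the three side lengths. -/
theorem cos_turn (α : ℝ) (c p q : Event) {C : ℝ}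
    (hC : ‖relA α c q * conj (relA α c p) - relB α c q * conj (relB α c p)‖ = C) :
    2 * (‖relA α c p‖ * ‖relA α c q‖ * C * Real.cos (turn α c p q)) =
      ‖relA α c p‖ ^ 2 + ‖relA α c q‖ ^ 2 + (C ^ 2 - 1) := by
  rw [relA_mul_conj_sub, norm_mul, norm_exp_ofReal_mul_I, mul_one, norm_real,
    Real.norm_of_nonneg (by positivity)] at hC
  have h1 := norm_relB_sq α c p
  have h2 := norm_relB_sq α c q
  have hp := norm_pos_iff.2 (relA_ne_zero α c p)
  have hq := norm_pos_iff.2 (relA_ne_zero α c q)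
  have hz : ‖relB α c q / relA α c q * conj (relB α c p / relA α c p)‖ ^ 2 *
      (‖relA α c q‖ ^ 2 * ‖relA α c p‖ ^ 2) =
      (‖relA α c q‖ ^ 2 - 1) * (‖relA α c p‖ ^ 2 - 1) := by
    rw [← h1, ← h2, norm_mul, norm_conj, norm_div, norm_div]
    field_simp
  rw [turn, Real.cos_neg]
  generalize relB α c q / relA α c q * conj (relB α c p / relA α c p) = z at *
  have h3 : ‖1 - z‖ * Real.cos (arg (1 - z)) = 1 - z.re := by
    rw [norm_mul_cos_arg, sub_re, one_re]
  have h4 : ‖1 - z‖ ^ 2 = 1 - 2 * z.re + ‖z‖ ^ 2 := by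
    rw [← normSq_eq_norm_sq, ← normSq_eq_norm_sq, normSq_apply, normSq_apply]
    simp; ring
  rw [← hC]
  generalize ‖relA α c p‖ = x at *
  generalize ‖relA α c q‖ = y at *
  linear_combination 2 * x ^ 2 * y ^ 2 * h3 - x ^ 2 * y ^ 2 * h4 - hz

theorem inner_flow (α : ℝ) (p v : Event) : inner α p flow v = -energy α p v := by
  simp [inner, flow, energy, metric, dotProduct, mulVec, Fin.sum_univ_four]
  ring

theorem normSq_ampV (α : ℝ) (p v : Event) :
    normSq (ampV α p v) = α ^ 2 * (inner α p v v + energy α p v ^ 2 - v 3 ^ 2) := by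
  rw [ampV, normSq_mul, normSq_baseVel, normSq_eq_norm_sq (_ ^ 2), norm_pow, norm_phase]
  ring

/-- All that the lower bound uses about a null geodesic segment: `S` is the hyperbolic sine of
half the hyperbolic distance between the fluid lines of its endpoints, and `G` is its delay. -/
theorem NullGeodesicSegment.exists_delay {α : ℝ} (hα : 0 < α) {p q : Event}
    (seg : NullGeodesicSegment α p q) (c : Event) : ∃ S G : ℝ, 0 ≤ S ∧ S ≤ 1 ∧
      minDelay * S ≤ G ∧ 0 < G ∧ relAngle α c q - relAngle α c p = turn α c p q - G ∧
      2 * (‖relA α c p‖ * ‖relA α c q‖ * √(1 + S ^ 2) * Real.cos (turn α c p q)) =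
        ‖relA α c p‖ ^ 2 + ‖relA α c q‖ ^ 2 + S ^ 2 := by
  obtain ⟨a, b, hab, γ, v, hgeo, hnull, rfl, rfl⟩ := seg
  obtain ⟨hn, hE⟩ := hnull a (Set.left_mem_Icc.2 hab.le)
  rw [inner_flow, neg_lt_zero] at hE
  have hV := normSq_ampV α (γ a) (v a)
  rw [hn, zero_add] at hV
  have hV0 := normSq_nonneg (ampV α (γ a) (v a))
  set E := energy α (γ a) (v a) with hEdef
  set Z := v a 3
  have hr := rate_sq α
  have hr0 : 0 < rate α := by unfold rate; positivity
  set e := rate α * E with he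
  have he0 : 0 < e := mul_pos hr0 hE
  have hα2 : 0 < α ^ 2 := by positivity
  have hZE : Z ^ 2 ≤ E ^ 2 := by
    rw [hV] at hV0
    have := nonneg_of_mul_nonneg_right hV0 hα2
    linarith
  set Ω := √(α ^ 2 * (E ^ 2 + Z ^ 2)) with hΩdef
  have hΩ : 0 < Ω := Real.sqrt_pos.2 (by positivity)
  have hΩ2 : Ω ^ 2 = α ^ 2 * (E ^ 2 + Z ^ 2) := Real.sq_sqrt (by positivity)
  have hΩV : Ω ^ 2 = 4 * e ^ 2 - normSq (ampV α (γ a) (v a)) := by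
    rw [hΩ2, hV, he, mul_pow]
    linear_combination -2 * E ^ 2 * hr
  set κ := 2 * e / Ω with hκdef
  have hκ : 0 < κ := by positivity
  have hκe : κ * Ω = 2 * e := by rw [hκdef]; field_simp
  have he2 : (2 * e) ^ 2 = α ^ 2 * (2 * E ^ 2) := by
    rw [he]; linear_combination 2 * E ^ 2 * hr
  have hκ1 : 1 ≤ κ := by
    rw [hκdef, one_le_div hΩ]
    refine le_of_sq_le_sq ?_ (by positivity)
    rw [he2, hΩ2]
    gcongr
    linarith
  have hκ2 : κ ^ 2 ≤ 2 := by
    rw [hκdef, div_pow, div_le_iff₀ (by positivity), he2, hΩ2]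
    nlinarith [mul_nonneg hα2.le (sq_nonneg Z)]
  have hσ : 0 < Ω * (b - a) := mul_pos hΩ (by linarith)
  have hb : b ∈ Set.Icc a b := Set.right_mem_Icc.2 hab.le
  set σ := Ω * (b - a) with hσdef
  have hS2 : (√(κ ^ 2 - 1) * |Real.sin σ|) ^ 2 = (κ ^ 2 - 1) * Real.sin σ ^ 2 := by
    rw [mul_pow, sq_abs, Real.sq_sqrt (by nlinarith)]
  have hsc := Real.sin_sq_add_cos_sq σ
  have hCeq : 1 + (√(κ ^ 2 - 1) * |Real.sin σ|) ^ 2 =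
      Real.cos σ ^ 2 + κ ^ 2 * Real.sin σ ^ 2 := by
    rw [hS2]; linear_combination -hsc
  refine ⟨√(κ ^ 2 - 1) * |Real.sin σ|, delay κ σ, by positivity, ?_,
    minDelay_mul_abs_le_delay hκ1 hκ2 hσ.le, delay_pos hκ1 hκ2 hσ,
    hgeo.relAngle_sub hab.le he hΩ hΩV hκ hκe c hb, ?_⟩
  · refine le_of_sq_le_sq ?_ zero_le_one
    rw [hS2]
    nlinarith [Real.sin_sq_le_one σ, sq_nonneg (Real.sin σ)]
  · have h1 := hgeo.rel_mul_conj hab.le he hΩ hΩV hκ hκe c hb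
    have h2 : ‖relA α c (γ b) * conj (relA α c (γ a)) - relB α c (γ b) * conj (relB α c (γ a))‖ =
        √(1 + (√(κ ^ 2 - 1) * |Real.sin σ|) ^ 2) := by
      rw [h1, norm_mul, ← ofReal_neg, norm_exp_ofReal_mul_I, mul_one, norm_real, hCeq,
        Real.norm_of_nonneg (Real.sqrt_nonneg _)]
    have h3 := cos_turn α c (γ a) (γ b) h2
    rw [h3, Real.sq_sqrt (by positivity)]
    ring

end

/-! ### The step inequalities -/

/-- The cosine lies below its tangent lines on `[-π / 2, π / 2]`. -/
theorem cos_le_tangent {θ t : ℝ} (h0 : 0 ≤ θ) (h1 : θ ≤ Real.pi / 2) (ht0 : -(Real.pi / 2) ≤ t)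
    (ht1 : t ≤ Real.pi / 2) : Real.cos t ≤ Real.cos θ - Real.sin θ * (t - θ) := by
  have hpi := Real.pi_pos
  obtain ⟨u, rfl⟩ : ∃ u, t = θ + u := ⟨t - θ, by ring⟩
  have hc : 0 ≤ Real.cos θ := Real.cos_nonneg_of_neg_pi_div_two_le_of_le (by linarith) h1
  have hs : 0 ≤ Real.sin θ := Real.sin_nonneg_of_nonneg_of_le_pi h0 (by linarith)
  have h2 := Real.cos_le_one u
  rw [Real.cos_add, add_sub_cancel_left]
  suffices 0 ≤ Real.cos θ * (1 - Real.cos u) + Real.sin θ * (Real.sin u - u) by linarith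
  rcases le_total u 0 with hu | hu
  · have := Real.le_sin hu
    exact add_nonneg (mul_nonneg hc (by linarith)) (mul_nonneg hs (by linarith))
  · have hu1 : u ≤ Real.pi / 2 - θ := by linarith
    have hsu : 0 ≤ Real.sin u := Real.sin_nonneg_of_nonneg_of_le_pi hu (by linarith)
    have hcu : 0 ≤ Real.cos u :=
      Real.cos_nonneg_of_neg_pi_div_two_le_of_le (by linarith) (by linarith)
    have h3 : Real.sin u ≤ Real.cos θ := by
      rw [← Real.sin_pi_div_two_sub]
      exact Real.sin_le_sin_of_le_of_le_pi_div_two (by linarith) (by linarith) hu1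
    have h4 : Real.sin θ ≤ Real.cos u := by
      rw [← Real.cos_pi_div_two_sub]
      exact Real.cos_le_cos_of_nonneg_of_le_pi hu (by linarith) hu1
    have h5 : u * Real.cos u ≤ Real.sin u := by
      rcases hcu.eq_or_lt with h | h
      · rw [← h, mul_zero]; exact hsu
      · have hlt : u < Real.pi / 2 := by
          refine lt_of_le_of_ne (by linarith) fun hh => ?_
          rw [hh, Real.cos_pi_div_two] at h
          exact lt_irrefl _ h
        have := Real.le_tan hu hlt
        rwa [Real.tan_eq_sin_div_cos, le_div_iff₀ h] at this
    have h6 : Real.sin u ≤ u := Real.sin_le hu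
    have h7 := mul_le_mul_of_nonneg_right h3 (sub_nonneg.2 h2)
    have h8 := mul_le_mul_of_nonneg_right h4 (sub_nonneg.2 h6)
    nlinarith

/-- The left side is `θ + cot θ - 1 / (q S)` for the angle `θ` with `sin θ = q S / √(1 + S²)`, as
it occurs in `turn_le_of_cosh_law`; the difference of the two sides has a nonnegative derivative.
-/
theorem arctan_add_le {q S : ℝ} (hq0 : 0 < q) (hq1 : q < 1) (hS : 0 ≤ S) :
    Real.arctan (q * S / √(1 + (1 - q ^ 2) * S ^ 2)) +
        (1 - q ^ 2) / q * (S / (1 + √(1 + (1 - q ^ 2) * S ^ 2))) ≤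
      ((1 + q ^ 2) / (2 * q) - (1 - q ^ 2) ^ 2 / (8 * q)) * Real.arctan S +
        (1 - q ^ 2) ^ 2 / (8 * q) * S := by
  have hr : 0 < 1 - q ^ 2 := by nlinarith
  set r := 1 - q ^ 2 with hrdef
  have key : ∀ x : ℝ, HasDerivAt (fun S =>
        ((1 + q ^ 2) / (2 * q) - r ^ 2 / (8 * q)) * Real.arctan S +
        r ^ 2 / (8 * q) * S - (Real.arctan (q * S / √(1 + r * S ^ 2)) +
        r / q * (S / (1 + √(1 + r * S ^ 2)))))
      (r * (√(1 + r * x ^ 2) - 1) ^ 2 * (√(1 + r * x ^ 2) + 3) /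
        (8 * q * (1 + √(1 + r * x ^ 2)) * (1 + x ^ 2))) x := by
    intro x
    have hp : 0 < 1 + r * x ^ 2 := by positivity
    have hR := Real.sqrt_pos.2 hp
    have hR2 : √(1 + r * x ^ 2) ^ 2 = 1 + r * x ^ 2 := Real.sq_sqrt hp.le
    have d1 : HasDerivAt (fun S : ℝ => 1 + r * S ^ 2) (2 * r * x) x := by
      have := (((hasDerivAt_id x).pow 2).const_mul r).const_add 1
      refine this.congr_deriv ?_
      simp; ring
    have d2 := d1.sqrt hp.ne'
    have d3 := (((hasDerivAt_id x).const_mul q).div d2 hR.ne').arctan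
    have d4 := ((hasDerivAt_id x).div (d2.const_add 1) (by positivity)).const_mul (r / q)
    have d5 := ((hasDerivAt_id x).arctan.const_mul ((1 + q ^ 2) / (2 * q) - r ^ 2 / (8 * q))).add
      ((hasDerivAt_id x).const_mul (r ^ 2 / (8 * q)))
    refine (d5.sub (d3.add d4)).congr_deriv ?_
    simp only [id, Pi.div_apply]
    have e1 : q ^ 2 = 1 - r := by rw [hrdef]; ring
    have e2 : 1 + (q * x / √(1 + r * x ^ 2)) ^ 2 = (1 + x ^ 2) / √(1 + r * x ^ 2) ^ 2 := by
      have : √(1 + r * x ^ 2) ^ 2 ≠ 0 := by positivity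
      rw [div_pow, eq_div_iff this, add_mul, div_mul_cancel₀ _ this, hR2]
      linear_combination x ^ 2 * e1
    rw [e2]
    generalize √(1 + r * x ^ 2) = R at *
    clear d1 d2 d3 d4 d5 e2 hrdef
    have h1 : (1 + R) ≠ 0 := by positivity
    have h2 : (1 + x ^ 2) ≠ 0 := by positivity
    field_simp
    grind
  have hm : MonotoneOn (fun S => ((1 + q ^ 2) / (2 * q) - r ^ 2 / (8 * q)) * Real.arctan S +
        r ^ 2 / (8 * q) * S - (Real.arctan (q * S / √(1 + r * S ^ 2)) +
        r / q * (S / (1 + √(1 + r * S ^ 2))))) Set.univ := by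
    refine monotoneOn_of_deriv_nonneg convex_univ
      (fun x _ => (key x).continuousAt.continuousWithinAt)
      (fun x _ => (key x).differentiableAt.differentiableWithinAt) fun x _ => ?_
    rw [(key x).deriv]
    positivity
  have := hm (Set.mem_univ 0) (Set.mem_univ S) hS
  simp at this
  linarith

/-- An upper bound for the turn `t` from the law of cosines, written in `δ = log a' - log a` and
`Y = log a + log a'`. The cosine is bounded by its tangent at the angle `θ` with
`sin θ = q S / √(1 + S²)`; the parameter `q` is free. -/
theorem turn_le_of_cosh_law {q c h f m S Y δ t B : ℝ} (hq0 : 0 < q) (hq1 : q < 1) (hS : 0 < S)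
    (ht : |t| ≤ Real.pi / 2)
    (hlaw : Real.cosh δ + S ^ 2 / 2 * Real.exp (-Y) = √(1 + S ^ 2) * Real.cos t)
    (hB : B ≤ S / (2 * q) * Real.exp (-Y) + h * Y)
    (hc : c + f ^ 2 * q / 2 + (1 - q ^ 2) ^ 2 / (8 * q) ≤ m)
    (hF : 0 ≤ c * S + B - ((1 + q ^ 2) / (2 * q) - (1 - q ^ 2) ^ 2 / (8 * q)) * Real.arctan S) :
    t ≤ m * S + h * Y - f * δ := by
  have hr : 0 < 1 - q ^ 2 := by nlinarith
  have hL := arctan_add_le hq0 hq1 hS.le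
  set r := 1 - q ^ 2 with hrdef
  have hp : 0 < 1 + r * S ^ 2 := by positivity
  have hR := Real.sqrt_pos.2 hp
  have hR2 : √(1 + r * S ^ 2) ^ 2 = 1 + r * S ^ 2 := Real.sq_sqrt hp.le
  have hC : 0 < √(1 + S ^ 2) := Real.sqrt_pos.2 (by positivity)
  set R := √(1 + r * S ^ 2) with hRdef
  have hx : 0 < q * S / R := by positivity
  have hsq : √(1 + (q * S / R) ^ 2) = √(1 + S ^ 2) / R := by
    rw [Real.sqrt_eq_iff_mul_self_eq (by positivity) (by positivity), ← sq, div_pow,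
      Real.sq_sqrt (by positivity), div_pow, hR2]
    field_simp
    rw [Real.sq_sqrt (by positivity), hrdef]; ring
  set θ := Real.arctan (q * S / R) with hθ
  have hθ0 : 0 ≤ θ := Real.arctan_nonneg.2 hx.le
  have hθ1 : θ ≤ Real.pi / 2 := (Real.arctan_lt_pi_div_two _).le
  have hcos : Real.cos θ = R / √(1 + S ^ 2) := by
    rw [hθ, Real.cos_arctan, hsq]; field_simp
  have hsin : Real.sin θ = q * S / √(1 + S ^ 2) := by
    rw [hθ, Real.sin_arctan, hsq]; field_simp
  have htan := cos_le_tangent hθ0 hθ1 (neg_le_of_abs_le ht) (le_of_abs_le ht)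
  rw [hcos, hsin] at htan
  have h1 : √(1 + S ^ 2) * Real.cos t ≤ R - q * S * (t - θ) := by
    have := mul_le_mul_of_nonneg_left htan hC.le
    refine this.trans (le_of_eq ?_)
    field_simp
  rw [← hlaw] at h1
  have h2 : 1 + δ ^ 2 / 2 ≤ Real.cosh δ := by
    have h := Real.cosh_two_mul (δ / 2)
    have h' := Real.cosh_sq (δ / 2)
    rw [mul_div_cancel₀ δ two_ne_zero] at h
    have hs : |δ / 2| ≤ |Real.sinh (δ / 2)| := by
      rw [Real.abs_sinh]; exact Real.self_le_sinh_iff.2 (abs_nonneg _)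
    have := sq_le_sq.2 hs
    linarith
  -- divide the tangent-line bound by `q * S`
  have h3 : t ≤ θ + (R - 1) / (q * S) - δ ^ 2 / (2 * (q * S)) - S / (2 * q) * Real.exp (-Y) := by
    have : q * S * t ≤ q * S * (θ + (R - 1) / (q * S) - δ ^ 2 / (2 * (q * S)) -
        S / (2 * q) * Real.exp (-Y)) := by
      have e : q * S * (θ + (R - 1) / (q * S) - δ ^ 2 / (2 * (q * S)) -
        S / (2 * q) * Real.exp (-Y)) = q * S * θ + (R - 1) - δ ^ 2 / 2 -
          S ^ 2 / 2 * Real.exp (-Y) := by field_simp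
      rw [e]; linarith
    exact le_of_mul_le_mul_left this (by positivity)
  have h4 : (R - 1) / (q * S) = r / q * (S / (1 + R)) := by
    field_simp
    linear_combination hR2
  have h5 : f * δ ≤ δ ^ 2 / (2 * (q * S)) + f ^ 2 * q / 2 * S := by
    have : 0 ≤ (δ - f * (q * S)) ^ 2 / (2 * (q * S)) := by positivity
    have e : (δ - f * (q * S)) ^ 2 / (2 * (q * S)) =
        δ ^ 2 / (2 * (q * S)) + f ^ 2 * q / 2 * S - f * δ := by
      field_simp; ring
    linarith
  have h6 := mul_le_mul_of_nonneg_right hc hS.le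
  rw [h4] at h3
  linarith

/-- The chord identity which shows that the cubic with coefficients `c, h, k, h` is convex on the
positive axis if `c` and `h` are nonnegative. -/
theorem convex_cubic {c h k t s u : ℝ} :
    (c * t ^ 3 + h * t ^ 2 + k * t + h) * (u - s) + (c * u ^ 3 + h * u ^ 2 + k * u + h) * (s - t) -
      (c * s ^ 3 + h * s ^ 2 + k * s + h) * (u - t) =
      (u - s) * (s - t) * (u - t) * (h + c * (t + s + u)) := by ring

/-- The function of the chord `S` whose positivity is the step inequality, in the range `S ≥ S₀`
where the minimum over the size of the triangle is interior. -/
def profile (c h K S₀ S : ℝ) : ℝ := c * S + h * (1 + Real.log (S / S₀)) - K * Real.arctan S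

theorem hasDerivAt_profile {c h K S₀ S : ℝ} (h0 : 0 < S₀) (hS : 0 < S) :
    HasDerivAt (profile c h K S₀)
      ((c * S ^ 3 + h * S ^ 2 + (c - K) * S + h) / (S * (1 + S ^ 2))) S := by
  have d1 := (((hasDerivAt_id S).div_const S₀).log (div_pos hS h0).ne').const_add 1
  have d2 := (((hasDerivAt_id S).const_mul c).add (d1.const_mul h)).sub
    ((hasDerivAt_id S).arctan.const_mul K)
  refine d2.congr_deriv ?_
  simp only [id]
  field_simp
  ring

theorem profile_mono {c h K S₀ a b : ℝ} (h0 : 0 < S₀) (ha : 0 < a) (hab : a ≤ b)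
    (hN : ∀ s ∈ Set.Icc a b, 0 ≤ c * s ^ 3 + h * s ^ 2 + (c - K) * s + h) :
    profile c h K S₀ a ≤ profile c h K S₀ b := by
  have hd : ∀ x ∈ Set.Icc a b, HasDerivAt (profile c h K S₀)
      ((c * x ^ 3 + h * x ^ 2 + (c - K) * x + h) / (x * (1 + x ^ 2))) x :=
    fun x hx => hasDerivAt_profile h0 (ha.trans_le hx.1)
  refine monotoneOn_of_deriv_nonneg (convex_Icc a b)
    (fun x hx => (hd x hx).continuousAt.continuousWithinAt)
    (fun x hx => (hd x (interior_subset hx)).differentiableAt.differentiableWithinAt) ?_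
    (Set.left_mem_Icc.2 hab) (Set.right_mem_Icc.2 hab) hab
  intro x hx
  have hx' := interior_subset hx
  rw [(hd x hx').deriv]
  have : 0 < x := ha.trans_le hx'.1
  have := hN x hx'
  positivity

theorem profile_anti {c h K S₀ a b : ℝ} (h0 : 0 < S₀) (ha : 0 < a) (hab : a ≤ b)
    (hN : ∀ s ∈ Set.Icc a b, c * s ^ 3 + h * s ^ 2 + (c - K) * s + h ≤ 0) :
    profile c h K S₀ b ≤ profile c h K S₀ a := by
  have hneg : ∀ x, profile (-c) (-h) (-K) S₀ x = -profile c h K S₀ x := fun x => by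
    simp only [profile]; ring
  have := profile_mono (c := -c) (h := -h) (K := -K) h0 ha hab fun s hs => by
    linarith [hN s hs]
  rw [hneg, hneg] at this
  linarith

/-- A nonnegativity criterion that needs only values at the endpoints: by convexity of the cubic
in its derivative, `profile` first increases and then decreases on `[a, b]`. -/
theorem profile_nonneg {c h K S₀ a b s : ℝ} (h0 : 0 < S₀) (hc : 0 ≤ c) (hh : 0 < h) (ha : 0 < a)
    (hs : s ∈ Set.Icc a b) (hNb : c * b ^ 3 + h * b ^ 2 + (c - K) * b + h ≤ 0)
    (hFa : 0 ≤ profile c h K S₀ a) (hFb : 0 ≤ profile c h K S₀ b) :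
    0 ≤ profile c h K S₀ s := by
  have hs0 : 0 < s := ha.trans_le hs.1
  rcases lt_or_ge 0 (c * s ^ 3 + h * s ^ 2 + (c - K) * s + h) with hN | hN
  · refine hFa.trans (profile_mono h0 ha hs.1 fun t ht => ?_)
    by_contra! hlt
    have ht0 : 0 < t := ha.trans_le ht.1
    have e := convex_cubic (c := c) (h := h) (k := c - K) (t := t) (s := s) (u := b)
    have hts : t < s := lt_of_le_of_ne ht.2 (by rintro rfl; linarith)
    have hsb : s < b := lt_of_le_of_ne hs.2 (by rintro rfl; linarith)
    have h1 : 0 ≤ (b - s) * (s - t) * (b - t) * (h + c * (t + s + b)) := by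
      have : 0 < b := by linarith
      have := sub_nonneg.2 hts.le
      have := sub_nonneg.2 hsb.le
      have := sub_nonneg.2 (hts.trans hsb).le
      positivity
    have h2 := mul_neg_of_neg_of_pos hlt (sub_pos.2 hsb)
    have h3 := mul_nonneg (neg_nonneg.2 hNb) (sub_nonneg.2 hts.le)
    have h4 := mul_pos hN (sub_pos.2 (hts.trans hsb))
    linarith
  · refine hFb.trans (profile_anti h0 hs0 hs.2 fun t ht => ?_)
    by_contra! hlt
    have ht0 : 0 < t := hs0.trans_le ht.1
    have e := convex_cubic (c := c) (h := h) (k := c - K) (t := s) (s := t) (u := b)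
    have hts : s < t := lt_of_le_of_ne ht.1 (by rintro rfl; linarith)
    have hsb : t < b := lt_of_le_of_ne ht.2 (by rintro rfl; linarith)
    have h1 : 0 ≤ (b - t) * (t - s) * (b - s) * (h + c * (s + t + b)) := by
      have : 0 < b := by linarith
      have := sub_nonneg.2 hts.le
      have := sub_nonneg.2 hsb.le
      have := sub_nonneg.2 (hts.trans hsb).le
      positivity
    have h2 := mul_nonneg (neg_nonneg.2 hN) (sub_nonneg.2 hsb.le)
    have h3 := mul_nonneg (neg_nonneg.2 hNb) (sub_nonneg.2 hts.le)
    have h4 := mul_pos hlt (sub_pos.2 (hts.trans hsb))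
    linarith

theorem arctan_le_self {x : ℝ} (hx : 0 ≤ x) : Real.arctan x ≤ x := by
  simpa using Real.le_tan (Real.arctan_nonneg.2 hx) (Real.arctan_lt_pi_div_two x)

/-- The lower bound `B` is the minimum over `Y ≥ 0` of the right side: at `Y = 0` for a short
chord and at `Y = log (S / (2 h q))` for a long one. -/
theorem le_of_profile_nonneg {q c h S Y : ℝ} {K : ℝ} (hq0 : 0 < q) (hh : 0 < h) (hK : 0 ≤ K)
    (hS : 0 < S) (hS1 : S ≤ 1) (hY : 0 ≤ Y) (hsmall : K ≤ c + 1 / (2 * q))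
    (hprof : ∀ s ∈ Set.Icc (2 * h * q) 1, 0 ≤ profile c h K (2 * h * q) s) :
    ∃ B, B ≤ S / (2 * q) * Real.exp (-Y) + h * Y ∧ 0 ≤ c * S + B - K * Real.arctan S := by
  have hS0 : 0 < 2 * h * q := by positivity
  rcases le_total S (2 * h * q) with hle | hle
  · refine ⟨S / (2 * q), ?_, ?_⟩
    · have h1 := Real.add_one_le_exp (-Y)
      have h2 : S / (2 * q) ≤ h := by
        rw [div_le_iff₀ (by positivity)]; linarith
      have h3 : 0 ≤ S / (2 * q) := by positivity
      nlinarith [mul_le_mul_of_nonneg_left h1 h3, mul_le_mul_of_nonneg_right h2 hY]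
    · have h1 : Real.arctan S ≤ S := arctan_le_self hS.le
      have h2 := mul_le_mul_of_nonneg_left h1 hK
      have h3 := mul_le_mul_of_nonneg_right hsmall hS.le
      have e : (c + 1 / (2 * q)) * S = c * S + S / (2 * q) := by ring
      linarith
  · refine ⟨h * (1 + Real.log (S / (2 * h * q))), ?_, ?_⟩
    · have h1 := Real.add_one_le_exp (Real.log (S / (2 * h * q)) - Y)
      rw [sub_eq_add_neg (Real.log _), Real.exp_add, Real.exp_log (by positivity)] at h1
      have h2 := mul_le_mul_of_nonneg_left h1 hh.le
      have e : h * (S / (2 * h * q) * Real.exp (-Y)) = S / (2 * q) * Real.exp (-Y) := by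
        field_simp
      linarith
    · have := hprof S ⟨hle, hS1⟩
      simp only [profile] at this
      linarith

/-- The step inequality with weights `e = f + h` at the start and `e' = f - h` at the end of the
step. -/
theorem turn_le_of_profile {q c h f m S a a' t : ℝ} (hq0 : 0 < q) (hq1 : q < 1) (hh : 0 < h)
    (ha : 1 ≤ a) (ha' : 1 ≤ a') (hS : 0 ≤ S) (hS1 : S ≤ 1) (ht : |t| ≤ Real.pi / 2)
    (hlaw : 2 * (a * a' * √(1 + S ^ 2) * Real.cos t) = a ^ 2 + a' ^ 2 + S ^ 2)
    (hK : 0 ≤ (1 + q ^ 2) / (2 * q) - (1 - q ^ 2) ^ 2 / (8 * q))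
    (hc : c + f ^ 2 * q / 2 + (1 - q ^ 2) ^ 2 / (8 * q) ≤ m)
    (hsmall : (1 + q ^ 2) / (2 * q) - (1 - q ^ 2) ^ 2 / (8 * q) ≤ c + 1 / (2 * q))
    (hprof : ∀ s ∈ Set.Icc (2 * h * q) 1,
      0 ≤ profile c h ((1 + q ^ 2) / (2 * q) - (1 - q ^ 2) ^ 2 / (8 * q)) (2 * h * q) s) :
    t ≤ m * S + (f + h) * Real.log a - (f - h) * Real.log a' := by
  have ha0 : 0 < a := by linarith
  have ha0' : 0 < a' := by linarith
  have hla := Real.log_nonneg ha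
  have hla' := Real.log_nonneg ha'
  rcases hS.eq_or_lt with rfl | hS
  · have hpi := Real.pi_pos
    simp only [ne_eq, OfNat.ofNat_ne_zero, not_false_eq_true, zero_pow, add_zero, Real.sqrt_one,
      mul_one] at hlaw
    have h1 := mul_le_mul_of_nonneg_left (Real.cos_le_one t) (mul_pos ha0 ha0').le
    have h2 : a' = a := by nlinarith [sq_nonneg (a - a')]
    subst h2
    have h3 : Real.cos t = 1 := by
      have : a' * a' * (Real.cos t - 1) = 0 := by linarith
      rcases mul_eq_zero.1 this with h | h
      · nlinarith
      · linarith
    have h4 : t = 0 := (Real.cos_eq_one_iff_of_lt_of_lt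
      (by linarith [neg_le_of_abs_le ht]) (by linarith [le_of_abs_le ht])).1 h3
    rw [h4]
    nlinarith
  · obtain ⟨B, hB, hF⟩ := le_of_profile_nonneg (Y := Real.log a + Real.log a') hq0 hh hK hS hS1
      (add_nonneg hla hla') hsmall hprof
    have hexp : Real.exp (-(Real.log a + Real.log a')) = (a * a')⁻¹ := by
      rw [Real.exp_neg, Real.exp_add, Real.exp_log ha0, Real.exp_log ha0']
    have hcosh : Real.cosh (Real.log a' - Real.log a) = (a ^ 2 + a' ^ 2) / (2 * (a * a')) := by
      rw [← Real.log_div ha0'.ne' ha0.ne', Real.cosh_log (by positivity)]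
      field_simp
      ring
    have := turn_le_of_cosh_law (δ := Real.log a' - Real.log a) (Y := Real.log a + Real.log a')
      hq0 hq1 hS ht (by
        rw [hexp, hcosh]
        field_simp
        linarith) hB hc hF
    linarith

theorem div_sqrt_le_arctan {x : ℝ} (hx : 0 ≤ x) : x / √(1 + x ^ 2) ≤ Real.arctan x := by
  rw [← Real.sin_arctan]
  exact Real.sin_le (Real.arctan_nonneg.2 hx)

/-- The tangent to the logarithm at `exp 1`, in the variable `1 / x`. -/
theorem two_sub_le_log {x : ℝ} (hx : 0 < x) : 2 - 2.7182818286 / x ≤ Real.log x := by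
  have h1 := Real.log_le_sub_one_of_pos (div_pos (Real.exp_pos 1) hx)
  rw [Real.log_div (Real.exp_pos 1).ne' hx.ne', Real.log_exp] at h1
  have h2 : Real.exp 1 / x ≤ 2.7182818286 / x := by
    gcongr
    exact Real.exp_one_lt_d9.le
  linarith

theorem arctan_four_fifths_le : Real.arctan (4 / 5) ≤ 0.67497 := by
  have h1 : Real.arctan (4 / 5) + Real.arctan (1 / 9) = Real.pi / 4 := by
    rw [Real.arctan_add (by norm_num)]; norm_num
  have h2 := div_sqrt_le_arctan (x := 1 / 9) (by norm_num)
  have h3 : √(1 + (1 / 9) ^ 2) ≤ 1.00616 := by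
    rw [Real.sqrt_le_left (by norm_num)]; norm_num
  have h4 : (1 / 9 : ℝ) / 1.00616 ≤ 1 / 9 / √(1 + (1 / 9) ^ 2) := by gcongr
  have := Real.pi_lt_d6
  norm_num at *
  linarith

theorem arctan_three_fourths_le : Real.arctan (3 / 4) ≤ 0.64400 := by
  have h1 : Real.arctan (3 / 4) + Real.arctan (1 / 7) = Real.pi / 4 := by
    rw [Real.arctan_add (by norm_num)]; norm_num
  have h2 := div_sqrt_le_arctan (x := 1 / 7) (by norm_num)
  have h3 : √(1 + (1 / 7) ^ 2) ≤ 1.01016 := by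
    rw [Real.sqrt_le_left (by norm_num)]; norm_num
  have h4 : (1 / 7 : ℝ) / 1.01016 ≤ 1 / 7 / √(1 + (1 / 7) ^ 2) := by gcongr
  have := Real.pi_lt_d6
  norm_num at *
  linarith

section

variable {S a a' t : ℝ}

/-- Step inequality for the weights `1.32` and `0.515`. -/
theorem turn_le_outer (ha : 1 ≤ a) (ha' : 1 ≤ a') (hS : 0 ≤ S) (hS1 : S ≤ 1)
    (ht : |t| ≤ Real.pi / 2)
    (hlaw : 2 * (a * a' * √(1 + S ^ 2) * Real.cos t) = a ^ 2 + a' ^ 2 + S ^ 2) :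
    t ≤ minDelay * S + 1.32 * Real.log a - 0.515 * Real.log a' := by
  have hm := minDelay_bounds.1
  have key := turn_le_of_profile (q := 0.49) (c := 0.1065) (h := 0.4025) (f := 0.9175)
    (m := minDelay) (by norm_num) (by norm_num) (by norm_num) ha ha' hS hS1 ht hlaw (by norm_num)
    (by norm_num at hm ⊢; linarith) (by norm_num) (by
      intro s hs
      refine profile_nonneg (b := 1) (by norm_num) (by norm_num) (by norm_num) (by norm_num) hs
        (by norm_num) ?_ ?_
      · have := arctan_le_self (x := 2 * 0.4025 * 0.49) (by norm_num)
        rw [profile, div_self (by norm_num), Real.log_one]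
        norm_num at this ⊢
        linarith
      · have := two_sub_le_log (x := 1 / (2 * 0.4025 * 0.49)) (by norm_num)
        have hpi := Real.pi_lt_d6
        rw [profile, Real.arctan_one]
        norm_num at this hpi ⊢
        linarith)
  norm_num at key ⊢
  exact key

/-- Step inequality for the weights `0.515` and `0.15`. -/
theorem turn_le_middle (ha : 1 ≤ a) (ha' : 1 ≤ a') (hS : 0 ≤ S) (hS1 : S ≤ 1)
    (ht : |t| ≤ Real.pi / 2)
    (hlaw : 2 * (a * a' * √(1 + S ^ 2) * Real.cos t) = a ^ 2 + a' ^ 2 + S ^ 2) :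
    t ≤ minDelay * S + 0.515 * Real.log a - 0.15 * Real.log a' := by
  have hm := minDelay_bounds.1
  -- a slightly smaller constant than available, for which the cubic vanishes exactly at `4 / 5`
  obtain ⟨c, hc⟩ : ∃ c : ℝ, c = ((1 + 0.76 ^ 2) / (2 * 0.76) - (1 - 0.76 ^ 2) ^ 2 / (8 * 0.76)) /
    (1 + 0.8 ^ 2) - 0.1825 / 0.8 := ⟨_, rfl⟩
  norm_num at hc
  have hb : 0 ≤ profile c 0.1825 ((1 + 0.76 ^ 2) / (2 * 0.76) - (1 - 0.76 ^ 2) ^ 2 / (8 * 0.76))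
      (2 * 0.1825 * 0.76) (4 / 5) := by
    have h1 := two_sub_le_log (x := 4 / 5 / (2 * 0.1825 * 0.76)) (by norm_num)
    have h2 := arctan_four_fifths_le
    rw [profile, hc]
    norm_num at h1 h2 ⊢
    linarith
  have key := turn_le_of_profile (q := 0.76) (c := c) (h := 0.1825) (f := 0.3325)
    (m := minDelay) (by norm_num) (by norm_num) (by norm_num) ha ha' hS hS1 ht hlaw (by norm_num)
    (by rw [hc]; norm_num at hm ⊢; linarith) (by rw [hc]; norm_num) (by
      intro s hs
      rcases le_total s (4 / 5) with h | h
      · refine profile_nonneg (b := 4 / 5) (by norm_num) (by rw [hc]; norm_num) (by norm_num)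
          (by norm_num) ⟨hs.1, h⟩ (by rw [hc]; norm_num) ?_ hb
        have := arctan_le_self (x := 2 * 0.1825 * 0.76) (by norm_num)
        rw [profile, div_self (by norm_num), Real.log_one, hc]
        norm_num at this ⊢
        linarith
      · refine hb.trans (profile_mono (by norm_num) (by norm_num) h fun x hx => ?_)
        have hx0 := sub_nonneg.2 hx.1
        obtain ⟨y, rfl⟩ : ∃ y, x = 4 / 5 + y := ⟨x - 4 / 5, by ring⟩
        have hy : 0 ≤ y := by linarith
        rw [hc]
        ring_nf
        positivity)
  norm_num at key ⊢
  exact key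

/-- Step inequality for the weights `0.15` and `-0.15`. -/
theorem turn_le_inner (ha : 1 ≤ a) (ha' : 1 ≤ a') (hS : 0 ≤ S) (hS1 : S ≤ 1)
    (ht : |t| ≤ Real.pi / 2)
    (hlaw : 2 * (a * a' * √(1 + S ^ 2) * Real.cos t) = a ^ 2 + a' ^ 2 + S ^ 2) :
    t ≤ minDelay * S + 0.15 * Real.log a + 0.15 * Real.log a' := by
  have hm := minDelay_bounds.1
  -- a slightly smaller constant than available, for which the cubic vanishes exactly at `3 / 4`
  obtain ⟨c, hc⟩ : ∃ c : ℝ, c = ((1 + 0.82 ^ 2) / (2 * 0.82) - (1 - 0.82 ^ 2) ^ 2 / (8 * 0.82)) /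
    (1 + 0.75 ^ 2) - 0.15 / 0.75 := ⟨_, rfl⟩
  norm_num at hc
  have hb : 0 ≤ profile c 0.15 ((1 + 0.82 ^ 2) / (2 * 0.82) - (1 - 0.82 ^ 2) ^ 2 / (8 * 0.82))
      (2 * 0.15 * 0.82) (3 / 4) := by
    have h1 := two_sub_le_log (x := 3 / 4 / (2 * 0.15 * 0.82)) (by norm_num)
    have h2 := arctan_three_fourths_le
    rw [profile, hc]
    norm_num at h1 h2 ⊢
    linarith
  have key := turn_le_of_profile (q := 0.82) (c := c) (h := 0.15) (f := 0)
    (m := minDelay) (by norm_num) (by norm_num) (by norm_num) ha ha' hS hS1 ht hlaw (by norm_num)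
    (by rw [hc]; norm_num at hm ⊢; linarith) (by rw [hc]; norm_num) (by
      intro s hs
      rcases le_total s (3 / 4) with h | h
      · refine profile_nonneg (b := 3 / 4) (by norm_num) (by rw [hc]; norm_num) (by norm_num)
          (by norm_num) ⟨hs.1, h⟩ (by rw [hc]; norm_num) ?_ hb
        have := arctan_le_self (x := 2 * 0.15 * 0.82) (by norm_num)
        rw [profile, div_self (by norm_num), Real.log_one, hc]
        norm_num at this ⊢
        linarith
      · refine hb.trans (profile_mono (by norm_num) (by norm_num) h fun x hx => ?_)
        obtain ⟨y, rfl⟩ : ∃ y, x = 3 / 4 + y := ⟨x - 3 / 4, by ring⟩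
        have hy : 0 ≤ y := by linarith [hx.1]
        rw [hc]
        ring_nf
        positivity)
  norm_num at key ⊢
  exact key

end

/-- The weight `1.32` is admissible for the first and last step, which start or end at the base
event. -/
theorem half_log_one_add_sq_lt {S : ℝ} (hS : 0 < S) (hS1 : S ≤ 1) :
    1.32 * Real.log √(1 + S ^ 2) < minDelay * S := by
  have hm := minDelay_bounds.1
  have h2 := Real.log_two_lt_d9
  have h1 : Real.log (1 + S ^ 2) ≤ Real.log 2 * S := by
    rcases le_total S (1 / 2) with h | h
    · have := Real.log_le_sub_one_of_pos (show 0 < 1 + S ^ 2 by positivity)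
      nlinarith [Real.log_two_gt_d9]
    · have := Real.log_le_sub_one_of_pos (show 0 < (1 + S ^ 2) / 2 by positivity)
      rw [Real.log_div (by positivity) two_ne_zero] at this
      nlinarith
  rw [Real.log_sqrt (by positivity)]
  nlinarith

/-! ### The lower bound -/

/-- The weights in `weightedAngle`. They are antisymmetric under `k ↦ 7 - k`, as reversing time
suggests, and are chosen to make the three step inequalities and `half_log_one_add_sq_lt` hold;
there is little room. Only `1 ≤ k ≤ 6` matters. -/
def weight (k : ℕ) : ℝ :=
  match k with
  | 1 => 1.32
  | 2 => 0.515
  | 3 => 0.15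
  | 4 => -0.15
  | 5 => -0.515
  | 6 => -1.32
  | _ => 0

/-- A quantity that does not increase from the `k`-th to the `(k + 1)`-st vertex of a lightlike
path that starts at `c`: it allows for the area which a polygon through `c` may gain while it
moves away from `c`. -/
def weightedAngle (α : ℝ) (k : ℕ) (c p : Event) : ℝ :=
  relAngle α c p + weight k * Real.log ‖relA α c p‖

theorem weightedAngle_self (α : ℝ) (k : ℕ) (c : Event) :
    weightedAngle α k c c = relAngle α c c := by
  rw [weightedAngle, norm_relA_self, Real.log_one, mul_zero, add_zero]

theorem turn_self_left (α : ℝ) (c p : Event) : turn α c c p = 0 := by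
  simp [turn, relB_self]

theorem turn_self_right (α : ℝ) (c p : Event) : turn α c p c = 0 := by
  simp [turn, relB_self]

/-- Law of cosines for a degenerate triangle. -/
theorem eq_sqrt_of_law {a S : ℝ}
    (h : 2 * (a * √(1 + S ^ 2)) = 1 + a ^ 2 + S ^ 2) : a = √(1 + S ^ 2) := by
  have h1 : √(1 + S ^ 2) ^ 2 = 1 + S ^ 2 := Real.sq_sqrt (by positivity)
  have : (a - √(1 + S ^ 2)) ^ 2 = 0 := by linear_combination h1 - h
  linarith [pow_eq_zero_iff (two_ne_zero) |>.1 this]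

theorem NullGeodesicSegment.weightedAngle_one_lt {α : ℝ} (hα : 0 < α) {c p : Event}
    (seg : NullGeodesicSegment α c p) : weightedAngle α 1 c p < relAngle α c c := by
  obtain ⟨S, G, hS, hS1, hG, hG0, hang, hlaw⟩ := seg.exists_delay hα c
  rw [turn_self_left] at hang hlaw
  rw [norm_relA_self, Real.cos_zero, one_pow, one_mul, mul_one] at hlaw
  have ha := eq_sqrt_of_law hlaw
  rw [weightedAngle, weight, ha]
  rcases hS.eq_or_lt with rfl | hS
  · simp; linarith
  · linarith [half_log_one_add_sq_lt hS hS1]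

theorem NullGeodesicSegment.relAngle_le_of_target {α : ℝ} (hα : 0 < α) {c p : Event}
    (seg : NullGeodesicSegment α p c) : relAngle α c c ≤ weightedAngle α 6 c p := by
  obtain ⟨S, G, hS, hS1, hG, hG0, hang, hlaw⟩ := seg.exists_delay hα c
  rw [turn_self_right] at hang hlaw
  rw [norm_relA_self, Real.cos_zero, one_pow, mul_one, mul_one] at hlaw
  have ha := eq_sqrt_of_law (S := S) (a := ‖relA α c p‖) (by rw [hlaw]; ring)
  rw [weightedAngle, weight, ha]
  rcases hS.eq_or_lt with rfl | hS
  · simp; linarith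
  · linarith [half_log_one_add_sq_lt hS hS1]

theorem NullGeodesicSegment.weightedAngle_succ_le {α : ℝ} (hα : 0 < α) {p q : Event}
    (seg : NullGeodesicSegment α p q) (c : Event) {k : ℕ} (hk : 1 ≤ k) (hk5 : k ≤ 5) :
    weightedAngle α (k + 1) c q ≤ weightedAngle α k c p := by
  obtain ⟨S, G, hS, hS1, hG, hG0, hang, hlaw⟩ := seg.exists_delay hα c
  have hp := one_le_norm_relA α c p
  have hq := one_le_norm_relA α c q
  have ht := (abs_turn_lt α c p q).le
  have hlaw' : 2 * (‖relA α c q‖ * ‖relA α c p‖ * √(1 + S ^ 2) * Real.cos (turn α c p q)) =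
      ‖relA α c q‖ ^ 2 + ‖relA α c p‖ ^ 2 + S ^ 2 := by rw [mul_comm ‖relA α c q‖, hlaw]; ring
  simp only [weightedAngle]
  interval_cases k <;> norm_num only [weight]
  · have := turn_le_outer hp hq hS hS1 ht hlaw
    norm_num at this; linarith
  · have := turn_le_middle hp hq hS hS1 ht hlaw
    norm_num at this; linarith
  · have := turn_le_inner hp hq hS hS1 ht hlaw
    norm_num at this; linarith
  · have := turn_le_middle hq hp hS hS1 ht hlaw'
    norm_num at this; linarith
  · have := turn_le_outer hq hp hS hS1 ht hlaw'
    norm_num at this; linarith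

theorem LightlikePath.weightedAngle_lt {α : ℝ} (hα : 0 < α) {c d : Event}
    (path : LightlikePath α c d) {k : ℕ} (hk : 1 ≤ k) (hk6 : k ≤ 6)
    (hkn : k < path.numSegments + 1) :
    weightedAngle α k c (path.vertex ⟨k, hkn⟩) < relAngle α c c := by
  induction k, hk using Nat.le_induction with
  | base =>
    have seg := path.segment ⟨0, path.numSegments_pos⟩
    have h0 : path.vertex (Fin.castSucc ⟨0, path.numSegments_pos⟩) = c := path.source
    rw [h0] at seg
    exact seg.weightedAngle_one_lt hα
  | succ k hk ih =>
    exact ((path.segment ⟨k, by omega⟩).weightedAngle_succ_le hα c hk (by omega)).trans_lt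
      (ih (by omega) (by omega))

theorem LightlikePath.eight_le_numSegments {α : ℝ} (hα : 0 < α) {c : Event}
    (path : LightlikePath α c c) : 8 ≤ path.numSegments := by
  by_contra! hlt
  have hn := path.numSegments_pos
  have hlast := path.target
  rcases Nat.lt_or_ge path.numSegments 7 with h | h
  · have h1 := path.weightedAngle_lt hα hn (by omega) (Nat.lt_succ_self _)
    rw [show (⟨path.numSegments, Nat.lt_succ_self _⟩ : Fin (path.numSegments + 1)) =
      Fin.last path.numSegments from rfl, hlast, weightedAngle_self] at h1
    exact lt_irrefl _ h1
  · have h1 := path.weightedAngle_lt hα (k := 6) (by omega) le_rfl (by omega)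
    have seg := path.segment ⟨6, by omega⟩
    have h2 : (⟨6, by omega⟩ : Fin path.numSegments).succ = Fin.last path.numSegments := by
      ext; simp; omega
    rw [h2, hlast] at seg
    exact absurd (seg.relAngle_le_of_target hα) (not_le.2 h1)

/-! ### Construction of null geodesics -/

section

open Complex ComplexConjugate

theorem rate_pos {α : ℝ} (hα : 0 < α) : 0 < rate α := by unfold rate; positivity

/-- A solution of the reduced first-order system for the position `x + i y` and the horizontal
velocity `b + i c` in the plane of fluid lines gives a geodesic: `τ` is obtained by integration,
and the second derivatives that result are those in `accel`. -/
theorem exists_geodesic_of_plane_solution {α E : ℝ} (hα : 0 < α) {x y b c s m : ℝ → ℝ}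
    (hs : ∀ t, 0 < s t) (hsq : ∀ t, s t ^ 2 = 1 + x t ^ 2 + y t ^ 2)
    (hm : ∀ t, m t * s t = x t * c t - y t * b t)
    (hx : ∀ t, HasDerivAt x (b t * s t + m t * y t) t)
    (hy : ∀ t, HasDerivAt y (c t * s t - m t * x t) t)
    (hb : ∀ t, HasDerivAt b (-((4 * (rate α * E) - 2 * m t) * c t)) t)
    (hc : ∀ t, HasDerivAt c ((4 * (rate α * E) - 2 * m t) * b t) t)
    (hsd : ∀ t, HasDerivAt s (x t * b t + y t * c t) t) (τ ζ Z : ℝ) :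
    ∃ γ v : ℝ → Event, IsGeodesicOn α γ v Set.univ ∧ γ 0 0 = τ ∧ ∀ t,
      plane α (γ t) = ⟨x t, y t⟩ ∧ baseVel α (γ t) (v t) = ⟨b t, c t⟩ ∧
      energy α (γ t) (v t) = E ∧ γ t 3 = ζ + Z * t ∧ v t 3 = Z := by
  have hr := rate_pos hα
  have hr2 := rate_sq α
  have hα0 := hα.ne'
  have hmeq : m = fun t => (x t * c t - y t * b t) / s t := by
    funext t; rw [eq_div_iff (hs t).ne', hm]
  have hmd : ∀ t, HasDerivAt m
      ((4 * (rate α * E) - 2 * m t) * (x t * b t + y t * c t) / s t) t := by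
    intro t
    have h := (((hx t).mul (hc t)).sub ((hy t).mul (hb t))).div (hsd t) (hs t).ne'
    rw [← show m = (x * c - y * b) / s from hmeq] at h
    refine h.congr_deriv ?_
    have h1 := hs t
    have h2 := hm t
    have h3 := hsq t
    simp only [Pi.mul_apply, Pi.sub_apply]
    rw [div_eq_div_iff (by positivity) (by positivity), ← h2]
    ring
  have hcont : Continuous fun t => E - m t / rate α := by
    have : Continuous m := continuous_iff_continuousAt.2 fun t => (hmd t).continuousAt
    fun_prop
  have hstr : ∀ t, 1 + α ^ 2 * ((x t / α) ^ 2 + (y t / α) ^ 2) = s t ^ 2 := fun t => by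
    rw [hsq]; field_simp; ring
  have hsqrt2 : √2 = 2 * rate α / α := by rw [rate]; field_simp
  have hen : ∀ t, E - m t / rate α + √2 * α * (x t / α * ((c t * s t - m t * x t) / α) -
      y t / α * ((b t * s t + m t * y t) / α)) = E := by
    intro t
    have h1 : x t * (c t * s t - m t * x t) - y t * (b t * s t + m t * y t) = m t := by
      linear_combination -(s t) * hm t + m t * hsq t
    have h2 : x t / α * ((c t * s t - m t * x t) / α) -
      y t / α * ((b t * s t + m t * y t) / α) = m t / α ^ 2 := by
      conv_rhs => rw [← h1]
      field_simp
    rw [h2, hsqrt2]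
    have : 2 * rate α / α * α * (m t / α ^ 2) = m t / rate α := by
      rw [← hr2]; field_simp
    rw [this]; ring
  refine ⟨fun t => ![τ + ∫ u in (0 : ℝ)..t, (E - m u / rate α), x t / α, y t / α, ζ + Z * t],
    fun t => ![E - m t / rate α, (b t * s t + m t * y t) / α, (c t * s t - m t * x t) / α, Z],
    fun t _ => ⟨?_, ?_⟩, by simp, fun t => ⟨?_, ?_, ?_, by simp, by simp⟩⟩
  · refine HasDerivAt.hasDerivWithinAt (hasDerivAt_pi.2 fun i => ?_)
    fin_cases i
    · exact ((hcont.integral_hasStrictDerivAt 0 t).hasDerivAt).const_add τ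
    · exact (hx t).div_const α
    · exact (hy t).div_const α
    · simpa using ((hasDerivAt_id t).const_mul Z).const_add ζ
  · rw [christoffel_sum]
    refine HasDerivAt.hasDerivWithinAt (hasDerivAt_pi.2 fun i => ?_)
    have h1 := hs t
    have h2 := hm t
    have h3 := hsq t
    have hF : √2 * α * (E - m t / rate α + E) = 4 * (rate α * E) - 2 * m t := by
      rw [hsqrt2]; field_simp; ring
    have hu : x t / α * ((b t * s t + m t * y t) / α) + y t / α * ((c t * s t - m t * x t) / α) =
        s t * (x t * b t + y t * c t) / α ^ 2 := by
      field_simp; ring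
    have hK : s t * (s t)⁻¹ = 1 := mul_inv_cancel₀ h1.ne'
    have hα1 : α * α⁻¹ = 1 := mul_inv_cancel₀ hα0
    have hN : α ^ 2 * (((b t * s t + m t * y t) / α) ^ 2 + ((c t * s t - m t * x t) / α) ^ 2) -
        (α ^ 2) ^ 2 * (s t * (x t * b t + y t * c t) / α ^ 2) ^ 2 / s t ^ 2 =
        b t ^ 2 + c t ^ 2 - m t ^ 2 := by
      have e1 : α ^ 2 * (((b t * s t + m t * y t) / α) ^ 2 + ((c t * s t - m t * x t) / α) ^ 2) =
        (b t * s t + m t * y t) ^ 2 + (c t * s t - m t * x t) ^ 2 := by field_simp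
      have e2 : (α ^ 2) ^ 2 * (s t * (x t * b t + y t * c t) / α ^ 2) ^ 2 / s t ^ 2 =
        (x t * b t + y t * c t) ^ 2 := by field_simp
      rw [e1, e2]
      clear hstr hen hcont hmd hmeq hF hu e1 e2
      generalize s t = s at *
      generalize m t = m at *
      generalize x t = x at *
      generalize y t = y at *
      generalize b t = b at *
      generalize c t = c at *
      grind
    have hds := hsd t
    have hdm := hmd t
    have h4 : 1 + 1 / s t ^ 2 = (s t ^ 2 + 1) / s t ^ 2 := by field_simp
    fin_cases i
    · refine ((hdm.div_const (rate α)).const_sub E).congr_deriv ?_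
      simp only [accel, energy, cons_val, hstr, hen, hF, hu, Fin.zero_eta]
      rw [hsqrt2, ← hr2]
      field_simp
    · refine ((((hb t).mul hds).add (hdm.mul (hy t))).div_const α).congr_deriv ?_
      simp only [accel, energy, cons_val, hstr, hen, hF, hu, hN, Fin.mk_one]
      field_simp
      have hd := h1.ne'
      clear hstr hen hcont hmd hmeq hF hu hds hdm hsqrt2 hx hy hb hc hsd hs hsq hm hN hr2 hr hα1
      generalize s t = s at *
      generalize m t = m at *
      generalize x t = x at *
      generalize y t = y at *
      generalize b t = b at *
      generalize c t = c at *
      grind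
    · refine ((((hc t).mul hds).sub (hdm.mul (hx t))).div_const α).congr_deriv ?_
      simp only [accel, energy, cons_val, hstr, hen, hF, hu, hN, Fin.reduceFinMk]
      field_simp
      have hd := h1.ne'
      clear hstr hen hcont hmd hmeq hF hu hds hdm hsqrt2 hx hy hb hc hsd hs hsq hm hN hr2 hr hα1
      generalize s t = s at *
      generalize m t = m at *
      generalize x t = x at *
      generalize y t = y at *
      generalize b t = b at *
      generalize c t = c at *
      grind
    · exact hasDerivAt_const t Z
  · simp only [plane, cons_val]
    congr 1 <;> field_simp
  · have hst : stretch α ![τ + ∫ u in (0 : ℝ)..t, (E - m u / rate α), x t / α, y t / α, ζ + Z * t] =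
        s t := by
      simp only [stretch, cons_val, hstr]; exact Real.sqrt_sq (hs t).le
    simp only [baseVel, hst]
    simp only [cons_val]
    congr 1
    · field_simp
      rw [div_eq_iff (hs t).ne']
      have h2 := hm t
      have h3 := hsq t
      clear hst hstr hen hcont hmd hmeq hsqrt2 hx hy hb hc hsd hs hsq hm hr2 hr
      generalize s t = s at *
      generalize m t = m at *
      generalize x t = x at *
      generalize y t = y at *
      generalize b t = b at *
      generalize c t = c at *
      grind
    · field_simp
      rw [div_eq_iff (hs t).ne']
      have h2 := hm t
      have h3 := hsq t
      clear hst hstr hen hcont hmd hmeq hsqrt2 hx hy hb hc hsd hs hsq hm hr2 hr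
      generalize s t = s at *
      generalize m t = m at *
      generalize x t = x at *
      generalize y t = y at *
      generalize b t = b at *
      generalize c t = c at *
      grind
  · simp only [energy, cons_val]; exact hen t

/-- The solution of the linear system of `spinor_solution` with initial values `A₀`, `B₀` for the
two amplitudes and `V₀` for the rotating coefficient; exchanging `A₀` and `B₀` gives the other
amplitude. -/
def spinor (e Ω : ℝ) (V₀ A₀ B₀ : ℂ) (t : ℝ) : ℂ :=
  cexp (e * t * I) * ((Real.cos (Ω * t) - 2 * e / Ω * Real.sin (Ω * t) * I) * A₀ +
    V₀ / Ω * Real.sin (Ω * t) * conj B₀)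

theorem spinor_zero (e Ω : ℝ) (V₀ A₀ B₀ : ℂ) : spinor e Ω V₀ A₀ B₀ 0 = A₀ := by simp [spinor]

theorem hasDerivAt_spinor {e Ω : ℝ} (hΩ : 0 < Ω) {V₀ : ℂ} (hΩV : Ω ^ 2 = 4 * e ^ 2 - normSq V₀)
    (A₀ B₀ : ℂ) (t : ℝ) : HasDerivAt (spinor e Ω V₀ A₀ B₀)
      (-e * I * spinor e Ω V₀ A₀ B₀ t +
        V₀ * cexp (2 * e * t * I) * conj (spinor e Ω V₀ B₀ A₀ t)) t := by
  have hexp : HasDerivAt (fun t : ℝ => cexp (e * t * I)) (e * I * cexp (e * t * I)) t := by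
    have h1 : HasDerivAt (fun t : ℝ => (e * t * I : ℂ)) (e * I) t := by
      simpa using (((hasDerivAt_id t).const_mul e).ofReal_comp).mul_const I
    convert h1.cexp using 1
    ring
  have hlin : HasDerivAt (fun t : ℝ => Ω * t) Ω t := by
    simpa using (hasDerivAt_id t).const_mul Ω
  have hcos := hlin.cos.ofReal_comp
  have hsin := hlin.sin.ofReal_comp
  refine (hexp.mul (((hcos.sub ((hsin.const_mul (2 * e / Ω : ℂ)).mul_const I)).mul_const A₀).add
    ((hsin.const_mul (V₀ / Ω)).mul_const (conj B₀)))).congr_deriv ?_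
  have hΩ0 : (Ω : ℂ) ≠ 0 := by exact_mod_cast hΩ.ne'
  have hV : (Ω : ℂ) ^ 2 = 4 * e ^ 2 - V₀ * conj V₀ := by
    rw [mul_conj]; exact_mod_cast hΩV
  have he1 : cexp (2 * e * t * I) = cexp (e * t * I) ^ 2 := by
    rw [← Complex.exp_nat_mul]; congr 1; push_cast; ring
  have he2 : cexp (e * t * I) * conj (cexp (e * t * I)) = 1 := by
    rw [mul_conj, normSq_eq_norm_sq, ← ofReal_mul, norm_exp_ofReal_mul_I]; simp
  simp only [spinor, Pi.add_apply, Pi.sub_apply, map_mul, map_add, map_sub, map_div₀, conj_ofReal,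
    conj_I, conj_conj, map_ofNat, he1]
  push_cast
  generalize conj (cexp (e * t * I)) = w at *
  generalize cexp (e * t * I) = z at *
  generalize Complex.cos (Ω * t) = co at *
  generalize Complex.sin (Ω * t) = si at *
  generalize conj V₀ = W at *
  generalize conj B₀ = B at *
  clear hcos hsin hlin hexp he1 hΩV
  have hI := I_sq
  generalize I = i at *
  field_simp
  grind

end

section

open Complex ComplexConjugate

theorem hasDerivAt_re {f : ℝ → ℂ} {f' : ℂ} {t : ℝ} (h : HasDerivAt f f' t) :
    HasDerivAt (fun t => (f t).re) f'.re t :=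
  reCLM.hasFDerivAt.comp_hasDerivAt t h

theorem hasDerivAt_im {f : ℝ → ℂ} {f' : ℂ} {t : ℝ} (h : HasDerivAt f f' t) :
    HasDerivAt (fun t => (f t).im) f'.im t :=
  imCLM.hasFDerivAt.comp_hasDerivAt t h

theorem hasDerivAt_conj {f : ℝ → ℂ} {f' : ℂ} {t : ℝ} (h : HasDerivAt f f' t) :
    HasDerivAt (fun t => conj (f t)) (conj f') t :=
  conjCLE.toContinuousLinearMap.hasFDerivAt.comp_hasDerivAt t h

/-- From amplitudes back to the event: the position is `B conj A / |A|` and the horizontal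
velocity `V (conj A / |A|)²`, since `A / |A|` is the phase. -/
theorem exists_geodesic_of_spinor {α E : ℝ} (hα : 0 < α) {A B V : ℝ → ℂ}
    (hA : ∀ t, HasDerivAt A (-(rate α * E : ℝ) * I * A t + V t * conj (B t)) t)
    (hB : ∀ t, HasDerivAt B (-(rate α * E : ℝ) * I * B t + V t * conj (A t)) t)
    (hV : ∀ t, HasDerivAt V (2 * (rate α * E : ℝ) * I * V t) t)
    (h0 : A 0 * conj (A 0) - B 0 * conj (B 0) = 1) (τ ζ Z : ℝ) :
    ∃ γ v : ℝ → Event, IsGeodesicOn α γ v Set.univ ∧ γ 0 0 = τ ∧ ∀ t, A t ≠ 0 ∧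
      plane α (γ t) = B t * (conj (A t) / ‖A t‖) ∧
      baseVel α (γ t) (v t) = V t * (conj (A t) / ‖A t‖) ^ 2 ∧
      energy α (γ t) (v t) = E ∧ γ t 3 = ζ + Z * t ∧ v t 3 = Z := by
  set e : ℝ := rate α * E with he
  have hN : ∀ t, A t * conj (A t) - B t * conj (B t) = 1 := by
    intro t
    have hd : ∀ t, HasDerivAt (fun t => A t * conj (A t) - B t * conj (B t)) 0 t := by
      intro t
      refine (((hA t).mul (hasDerivAt_conj (hA t))).sub
        ((hB t).mul (hasDerivAt_conj (hB t)))).congr_deriv ?_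
      simp only [map_add, map_mul, map_neg, conj_ofReal, conj_I, conj_conj]
      ring
    rw [← h0]
    exact is_const_of_deriv_eq_zero (fun t => (hd t).differentiableAt) (fun t => (hd t).deriv) t 0
  have hnorm : ∀ t, (‖A t‖ : ℂ) ^ 2 = A t * conj (A t) := fun t => by
    rw [mul_conj, normSq_eq_norm_sq]; push_cast; rfl
  have hs2 : ∀ t, ‖A t‖ ^ 2 = 1 + ‖B t‖ ^ 2 := by
    intro t
    have h := hN t
    rw [mul_conj, mul_conj, normSq_eq_norm_sq, normSq_eq_norm_sq] at h
    have h' : ‖A t‖ ^ 2 - ‖B t‖ ^ 2 = 1 := by exact_mod_cast h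
    linarith
  have hs : ∀ t, 0 < ‖A t‖ := by
    intro t
    by_contra! h
    have h1 := hs2 t
    have h2 : ‖A t‖ = 0 := le_antisymm h (norm_nonneg _)
    rw [h2] at h1
    nlinarith [sq_nonneg ‖B t‖]
  have hsC : ∀ t, (‖A t‖ : ℂ) ≠ 0 := fun t => by exact_mod_cast (hs t).ne'
  have hsd : ∀ t, HasDerivAt (fun t => ‖A t‖) ((V t * conj (B t) * conj (A t)).re / ‖A t‖) t := by
    intro t
    have h1 : HasDerivAt (fun t => (A t * conj (A t)).re)
        (2 * (V t * conj (B t) * conj (A t)).re) t := by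
      refine (hasDerivAt_re ((hA t).mul (hasDerivAt_conj (hA t)))).congr_deriv ?_
      have : (-(e : ℂ) * I * A t + V t * conj (B t)) * conj (A t) +
          A t * conj (-(e : ℂ) * I * A t + V t * conj (B t)) =
          V t * conj (B t) * conj (A t) + conj (V t * conj (B t) * conj (A t)) := by
        simp only [map_add, map_mul, map_neg, conj_ofReal, conj_I, conj_conj]
        ring
      rw [this, add_re, conj_re]; ring
    have h2 : ∀ t, (A t * conj (A t)).re = ‖A t‖ ^ 2 := fun t => by
      rw [mul_conj, normSq_eq_norm_sq, ofReal_re]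
    have h3 := h1.sqrt (by rw [h2]; exact (pow_pos (hs t) 2).ne')
    simp only [h2, Real.sqrt_sq (norm_nonneg _)] at h3
    refine h3.congr_deriv ?_
    have := (hs t).ne'
    field_simp
  set Q : ℝ → ℂ := fun t => V t * conj (B t) * conj (A t) with hQ
  set u : ℝ → ℂ := fun t => conj (A t) / ‖A t‖ with hu
  set m : ℝ → ℝ := fun t => (Q t).im / ‖A t‖ ^ 2 with hm
  have hQre : ∀ t, ((Q t).re : ℂ) = conj (Q t) + (m t * ‖A t‖ ^ 2 : ℝ) * I := fun t => by
    have h1 : m t * ‖A t‖ ^ 2 = (Q t).im := div_mul_cancel₀ _ (pow_pos (hs t) 2).ne'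
    rw [h1]
    apply Complex.ext <;> simp
  have huu : ∀ t, u t * conj (u t) = 1 := fun t => by
    simp only [hu, map_div₀, conj_conj, conj_ofReal]
    have := hsC t
    have := hnorm t
    field_simp
    rw [this]; ring
  have hud : ∀ t, HasDerivAt u ((e - m t) * I * u t) t := by
    intro t
    refine ((hasDerivAt_conj (hA t)).div (hsd t).ofReal_comp (hsC t)).congr_deriv ?_
    have h1 := hsC t
    have h2 := hnorm t
    push_cast
    rw [hQre t]
    simp only [hu, hQ, map_add, map_mul, map_neg, conj_ofReal, conj_I, conj_conj]
    push_cast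
    field_simp
    rw [h2]
    ring
  have hwd : ∀ t, HasDerivAt (fun t => B t * u t)
      (V t * u t ^ 2 * ‖A t‖ - I * m t * (B t * u t)) t := by
    intro t
    refine ((hB t).mul (hud t)).congr_deriv ?_
    have h1 : conj (A t) = ‖A t‖ * u t := by
      have := hsC t
      simp only [hu]; field_simp
    rw [h1]; ring
  have hbd : ∀ t, HasDerivAt (fun t => V t * u t ^ 2)
      ((4 * e - 2 * m t : ℝ) * I * (V t * u t ^ 2)) t := by
    intro t
    refine ((hV t).mul ((hud t).pow 2)).congr_deriv ?_
    push_cast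
    simp only [Pi.pow_apply]
    ring
  have hwb : ∀ t, conj (B t * u t) * (V t * u t ^ 2) = Q t / ‖A t‖ := by
    intro t
    have h1 : conj (A t) = ‖A t‖ * u t := by
      have := hsC t
      simp only [hu]; field_simp
    have := hsC t
    rw [eq_div_iff this]
    simp only [hQ, map_mul, h1]
    linear_combination V t * conj (B t) * u t * ‖A t‖ * huu t
  obtain ⟨γ, v, h1, h2, h3⟩ := exists_geodesic_of_plane_solution (E := E) hα
    (x := fun t => (B t * u t).re)
    (y := fun t => (B t * u t).im) (b := fun t => (V t * u t ^ 2).re)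
    (c := fun t => (V t * u t ^ 2).im) (s := fun t => ‖A t‖) (m := m) hs
    (by
      intro t
      have : ‖B t * u t‖ ^ 2 = ‖B t‖ ^ 2 := by
        have h := huu t
        rw [mul_conj, normSq_eq_norm_sq] at h
        have h' : ‖u t‖ ^ 2 = 1 := by exact_mod_cast h
        rw [norm_mul, mul_pow, h', mul_one]
      rw [hs2, ← this, ← normSq_eq_norm_sq, normSq_apply]; ring)
    (by
      intro t
      have h := congrArg im (hwb t)
      rw [div_ofReal_im, mul_im, conj_re, conj_im] at h
      simp only [hm]
      have := (hs t).ne'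
      have e1 : (Q t).im / ‖A t‖ ^ 2 * ‖A t‖ = (Q t).im / ‖A t‖ := by field_simp
      rw [e1, ← h]; ring)
    (fun t => (hasDerivAt_re (hwd t)).congr_deriv (by
      generalize V t * u t ^ 2 = b; generalize B t * u t = w; simp))
    (fun t => (hasDerivAt_im (hwd t)).congr_deriv (by
      generalize V t * u t ^ 2 = b; generalize B t * u t = w; simp))
    (fun t => (hasDerivAt_re (hbd t)).congr_deriv (by
      generalize V t * u t ^ 2 = b; simp [he]))
    (fun t => (hasDerivAt_im (hbd t)).congr_deriv (by
      generalize V t * u t ^ 2 = b; simp [he]))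
    (fun t => (hsd t).congr_deriv (by
      have h := congrArg re (hwb t)
      rw [div_ofReal_re, mul_re, conj_re, conj_im] at h
      simp only [hQ] at h
      rw [← h]; ring)) τ ζ Z
  exact ⟨γ, v, h1, h2, fun t => ⟨norm_pos_iff.1 (hs t), h3 t⟩⟩

/-- Null geodesics with prescribed initial event, energy, `ζ`-velocity and horizontal velocity, as
long as these are compatible with a null vector and `Ω` is real. -/
theorem exists_nullGeodesicSegment {α : ℝ} (hα : 0 < α) (p : Event) {E Z Ω T : ℝ} {V₀ : ℂ}
    (hE : 0 < E) (hΩ : 0 < Ω) (hV : normSq V₀ = α ^ 2 * (E ^ 2 - Z ^ 2))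
    (hΩV : Ω ^ 2 = 4 * (rate α * E) ^ 2 - normSq V₀) :
    ∃ γ v : ℝ → Event, IsGeodesicOn α γ v (Set.Icc 0 T) ∧
      (∀ t ∈ Set.Icc 0 T, IsFutureNull α (γ t) (v t)) ∧ γ 0 = p ∧
      energy α (γ 0) (v 0) = E ∧ ampV α (γ 0) (v 0) = V₀ ∧ γ T 3 = p 3 + Z * T := by
  set e : ℝ := rate α * E with he
  obtain ⟨γ, v, hgeo, hτ, h⟩ := exists_geodesic_of_spinor (E := E) hα
    (A := spinor e Ω V₀ (ampA α p) (ampB α p)) (B := spinor e Ω V₀ (ampB α p) (ampA α p))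
    (V := fun t => V₀ * cexp (2 * e * t * I))
    (fun t => (hasDerivAt_spinor hΩ hΩV _ _ t).congr_deriv (by push_cast; rw [he]; push_cast; ring))
    (fun t => (hasDerivAt_spinor hΩ hΩV _ _ t).congr_deriv (by push_cast; rw [he]; push_cast; ring))
    (fun t => by
      have h1 : HasDerivAt (fun t : ℝ => (2 * e * t * I : ℂ)) (2 * e * I) t := by
        simpa using (((hasDerivAt_id t).const_mul (2 * e)).ofReal_comp).mul_const I
      refine (h1.cexp.const_mul V₀).congr_deriv ?_
      rw [← he]; ring)
    (by rw [spinor_zero, spinor_zero, ampA_mul_conj]) (p 0) (p 3) Z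
  have hA0 : ‖ampA α p‖ = stretch α p := by
    rw [ampA, norm_mul, norm_phase, mul_one, norm_real, Real.norm_of_nonneg (stretch_pos α p).le]
  have hs : (stretch α p : ℂ) ≠ 0 := by exact_mod_cast (stretch_pos α p).ne'
  have hph : conj (ampA α p) / ‖ampA α p‖ = conj (phase α p) := by
    rw [hA0, ampA, map_mul, conj_ofReal]; field_simp
  have hpp := phase_mul_conj α p
  have h0 : γ 0 = p := by
    obtain ⟨-, hp, -, -, hz, -⟩ := h 0
    rw [spinor_zero, spinor_zero, hph, ampB, mul_assoc, hpp, mul_one] at hp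
    have h1 := congrArg re hp
    have h2 := congrArg im hp
    simp only [plane] at h1 h2
    funext i
    fin_cases i
    · exact hτ
    · exact mul_left_cancel₀ hα.ne' h1
    · exact mul_left_cancel₀ hα.ne' h2
    · simpa using hz
  refine ⟨γ, v, fun t _ => ⟨(hgeo t trivial).1.mono (Set.subset_univ _),
    (hgeo t trivial).2.mono (Set.subset_univ _)⟩, fun t _ => ?_, h0,
    (h 0).2.2.2.1, ?_, (h T).2.2.2.2.1⟩
  · obtain ⟨hA, -, hb, hen, -, hz⟩ := h t
    rw [← norm_ne_zero_iff] at hA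
    refine ⟨?_, by rw [inner_flow, hen]; linarith⟩
    have h1 := normSq_baseVel α (γ t) (v t)
    rw [hb, hen, hz, normSq_mul, normSq_mul, hV, normSq_eq_norm_sq (_ ^ 2), norm_pow, norm_div,
      norm_conj, norm_real, norm_norm, div_self hA, normSq_eq_norm_sq (cexp _),
      show (2 * e * t * I : ℂ) = ((2 * e * t : ℝ) : ℂ) * I by push_cast; ring,
      norm_exp_ofReal_mul_I] at h1
    have hα2 : α ^ 2 ≠ 0 := by positivity
    have h2 : α ^ 2 * inner α (γ t) (v t) (v t) = 0 := by linarith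
    exact (mul_eq_zero.1 h2).resolve_left hα2
  · have hb := (h 0).2.2.1
    rw [spinor_zero, hph] at hb
    rw [ampV, hb, h0]
    simp only [ofReal_zero, mul_zero, zero_mul, Complex.exp_zero, mul_one]
    linear_combination V₀ * (phase α p * conj (phase α p) + 1) * hpp

end

/-! ### The octagon -/

section

open Complex ComplexConjugate

/-- The two equations say that `β ε - (1 + β) = i κ exp (i κ π / 4)` with `ε = exp (i π / 4)`.
They have a solution with `1 < κ < √2` by the intermediate value theorem. Null geodesics need
`κ ≤ √2`, and the analogous heptagon would violate this. -/
theorem exists_octagon_parameters : ∃ κ β : ℝ, 1 < κ ∧ κ ^ 2 < 2 ∧ 0 < β ∧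
    κ * Real.sin (κ * (Real.pi / 4)) = 1 + β * (1 - √2 / 2) ∧
    κ * Real.cos (κ * (Real.pi / 4)) = β * (√2 / 2) := by
  have h2 : √2 ^ 2 = 2 := Real.sq_sqrt (by norm_num : (0 : ℝ) ≤ 2)
  have h2l : 1.41421 < √2 := by
    rw [Real.lt_sqrt (by norm_num)]; norm_num
  have h2u : √2 < 1.41422 := by
    rw [Real.sqrt_lt' (by norm_num)]; norm_num
  have hpi := Real.pi_pos
  have hpi1 := Real.pi_gt_d6
  have hpi2 := Real.pi_lt_d6
  set C := Real.cos (Real.pi / 8) with hC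
  set S := Real.sin (Real.pi / 8) with hS
  have hC0 : 0 < C := Real.cos_pos_of_mem_Ioo ⟨by linarith, by linarith⟩
  have hS0 : 0 < S := Real.sin_pos_of_pos_of_lt_pi (by linarith) (by linarith)
  have hcc : 2 * C ^ 2 - 1 = √2 / 2 := by
    rw [hC, ← Real.cos_two_mul, ← Real.cos_pi_div_four]; congr 1; ring
  have hsc : 2 * S * C = √2 / 2 := by
    rw [hC, hS, ← Real.sin_two_mul, ← Real.sin_pi_div_four]; congr 1; ring
  have hSC : S = (√2 - 1) * C := by
    have : 2 * C * S = 2 * C * ((√2 - 1) * C) := by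
      linear_combination hsc - (√2 - 1) * hcc - h2 / 2
    exact mul_left_cancel₀ (by positivity) this
  -- eliminating `β` from the two equations leaves `f κ = cos (π / 8)`
  set f : ℝ → ℝ := fun κ => κ * Real.sin (κ * (Real.pi / 4) - Real.pi / 8) with hf
  have hfc : Continuous f := by fun_prop
  have hf1 : f 1 < C := by
    have : f 1 = S := by simp only [hf, hS]; rw [one_mul]; congr 1; ring
    rw [this, hSC]; nlinarith
  have hf2 : C < f √2 := by
    obtain ⟨δ, hδ⟩ : ∃ δ, δ = Real.pi / 8 * (3 - 2 * √2) := ⟨_, rfl⟩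
    have hδ0 : 0 ≤ δ := by rw [hδ]; exact mul_nonneg (by linarith) (by linarith)
    have hδ1 : δ ≤ 0.0675 := by rw [hδ]; nlinarith
    have e : √2 * (Real.pi / 4) - Real.pi / 8 = Real.pi / 4 - δ := by rw [hδ]; ring
    have : f √2 = Real.cos δ - Real.sin δ := by
      simp only [hf]
      rw [e, Real.sin_sub, Real.sin_pi_div_four, Real.cos_pi_div_four]
      linear_combination (Real.cos δ - Real.sin δ) / 2 * h2
    rw [this]
    have h3 := Real.one_sub_sq_div_two_le_cos (x := δ)
    have h4 := Real.sin_le hδ0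
    have h5 : C < 0.93 := by nlinarith
    nlinarith
  obtain ⟨κ, hκ, hκf⟩ := intermediate_value_Icc (show (1 : ℝ) ≤ √2 by linarith) hfc.continuousOn
    (show C ∈ Set.Icc (f 1) (f √2) from ⟨hf1.le, hf2.le⟩)
  have hκ1 : 1 < κ := lt_of_le_of_ne hκ.1 (by rintro rfl; linarith)
  have hκ2 : κ < √2 := lt_of_le_of_ne hκ.2 (by rintro rfl; linarith)
  have hcos : 0 < Real.cos (κ * (Real.pi / 4)) :=
    Real.cos_pos_of_mem_Ioo ⟨by nlinarith, by nlinarith⟩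
  refine ⟨κ, √2 * (κ * Real.cos (κ * (Real.pi / 4))), hκ1, ?_, by positivity, ?_, ?_⟩
  · nlinarith
  · simp only [hf] at hκf
    rw [Real.sin_sub, ← hC, ← hS, hSC] at hκf
    refine mul_left_cancel₀ hC0.ne' ?_
    linear_combination hκf + C * κ * Real.cos (κ * (Real.pi / 4)) / 2 * h2
  · linear_combination -(κ * Real.cos (κ * (Real.pi / 4))) / 2 * h2

/-- A null geodesic segment of half a turn that keeps the distance to the fluid line of `c` and
`relAngle`, and rotates the fluid line about that of `c` by an eighth of a full turn. The initial
horizontal velocity is chosen so that `relA` is preserved. -/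
theorem exists_octagon_side {α : ℝ} (hα : 0 < α) {κ β : ℝ} (hκ1 : 1 < κ) (hκ2 : κ ^ 2 < 2)
    (hβ : 0 < β) (hsin : κ * Real.sin (κ * (Real.pi / 4)) = 1 + β * (1 - √2 / 2))
    (hcos : κ * Real.cos (κ * (Real.pi / 4)) = β * (√2 / 2)) {c p : Event}
    (hp : ‖relA α c p‖ ^ 2 = 1 + β) {Z : ℝ} (hZ : κ ^ 2 * (1 + Z ^ 2) = 2) :
    ∃ q, Nonempty (NullGeodesicSegment α p q) ∧ relA α c q = relA α c p ∧
      relB α c q = cexp ((Real.pi / 4 : ℝ) * I) * relB α c p ∧ relAngle α c q = relAngle α c p ∧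
      q 3 = p 3 + Z * (Real.pi * κ / (4 * rate α)) := by
  have h2 : √2 ^ 2 = 2 := Real.sq_sqrt (by norm_num : (0 : ℝ) ≤ 2)
  have hpi := Real.pi_pos
  have hr := rate_pos hα
  have hr2 := rate_sq α
  obtain ⟨e, he⟩ : ∃ e, e = rate α := ⟨_, rfl⟩
  rw [← he] at hr hr2 ⊢
  have hκ0 : 0 < κ := by linarith
  obtain ⟨Ω, hΩ⟩ : ∃ Ω, Ω = 2 * e / κ := ⟨_, rfl⟩
  have hΩ0 : 0 < Ω := by rw [hΩ]; positivity
  have hκΩ : κ * Ω = 2 * e := by rw [hΩ]; field_simp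
  obtain ⟨T, hT⟩ : ∃ T, T = Real.pi * κ / (4 * e) := ⟨_, rfl⟩
  have hT0 : 0 < T := by rw [hT]; positivity
  have hΩT : Ω * T = Real.pi / 2 := by rw [hΩ, hT]; field_simp; norm_num
  have heT : e * T = κ * (Real.pi / 4) := by rw [hT]; field_simp
  set w := cexp ((κ * (Real.pi / 4) : ℝ) * I) with hw
  have hww : w * conj w = 1 := by
    rw [mul_conj, normSq_eq_norm_sq, norm_exp_ofReal_mul_I]; simp
  have hwre : w.re = Real.cos (κ * (Real.pi / 4)) := exp_ofReal_mul_I_re _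
  have hwim : w.im = Real.sin (κ * (Real.pi / 4)) := exp_ofReal_mul_I_im _
  set ε := cexp ((Real.pi / 4 : ℝ) * I) with hε
  have hstar : I * κ * w = β * ε - (1 + β) := by
    apply Complex.ext
    · have : (I * κ * w).re = -(κ * w.im) := by simp
      rw [this, hwim, hsin]
      have : (β * ε - (1 + β) : ℂ).re = β * ε.re - (1 + β) := by simp
      rw [this, hε, exp_ofReal_mul_I_re, Real.cos_pi_div_four]
      ring
    · have : (I * κ * w).im = κ * w.re := by simp
      rw [this, hwre, hcos]
      have : (β * ε - (1 + β) : ℂ).im = β * ε.im := by simp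
      rw [this, hε, exp_ofReal_mul_I_im, Real.sin_pi_div_four]
  have hAA : relA α c p * conj (relA α c p) = 1 + β := by
    rw [mul_conj, normSq_eq_norm_sq, hp]; push_cast; ring
  have hBB : relB α c p * conj (relB α c p) = β := by
    rw [mul_conj, normSq_eq_norm_sq, norm_relB_sq, hp]; push_cast; ring
  have hB0 : conj (relB α c p) ≠ 0 := by
    intro h
    rw [h, mul_zero] at hBB
    exact hβ.ne (by exact_mod_cast hBB)
  obtain ⟨V₀, hV₀⟩ : ∃ V₀ : ℂ, V₀ = Ω * (conj w + I * κ) * relA α c p / conj (relB α c p) :=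
    ⟨_, rfl⟩
  have hsc := Real.sin_sq_add_cos_sq (κ * (Real.pi / 4))
  have hVn : normSq V₀ = Ω ^ 2 * (κ ^ 2 - 1) := by
    have h1 : normSq (conj w + I * κ) = 1 + κ ^ 2 - 2 * (κ * Real.sin (κ * (Real.pi / 4))) := by
      rw [normSq_apply]
      simp only [add_re, add_im, conj_re, conj_im, mul_re, mul_im, I_re, I_im, ofReal_re, ofReal_im,
        hwre, hwim]
      linear_combination hsc
    have h3 : normSq (relB α c p) = β := by
      rw [normSq_eq_norm_sq, norm_relB_sq, hp]; ring
    rw [hV₀, map_div₀, map_mul, map_mul, normSq_conj, normSq_ofReal, h1, h3, hsin,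
      normSq_eq_norm_sq, hp]
    have h4 : κ ^ 2 = (1 + β * (1 - √2 / 2)) ^ 2 + (β * (√2 / 2)) ^ 2 := by
      rw [← hsin, ← hcos]; linear_combination -κ ^ 2 * hsc
    rw [h4, div_eq_iff hβ.ne']
    linear_combination (Ω ^ 2 * β ^ 2 / 2) * h2
  obtain ⟨γ, v, hgeo, hnull, h0, hen, hamp, hζ⟩ := exists_nullGeodesicSegment hα p (E := 1) (Z := Z)
    (T := T) one_pos hΩ0 (V₀ := V₀) (by
      rw [hVn, hΩ]
      field_simp
      linear_combination 2 * (κ ^ 2 - 1) * hr2 + α ^ 2 * hZ) (by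
      rw [hVn, mul_one, ← he]; linear_combination (κ * Ω + 2 * e) * hκΩ)
  have hT1 : T ∈ Set.Icc 0 T := ⟨hT0.le, le_rfl⟩
  have hΩV : Ω ^ 2 = 4 * e ^ 2 - normSq (ampV α (γ 0) (v 0)) := by
    rw [hamp, hVn]; linear_combination (κ * Ω + 2 * e) * hκΩ
  have heE : e = rate α * energy α (γ 0) (v 0) := by rw [hen, mul_one, he]
  obtain ⟨hA, hB⟩ := hgeo.rel_solution hT0.le heE hΩ0 hΩV c hT1
  have hang := hgeo.relAngle_sub hT0.le heE hΩ0 hΩV hκ0 hκΩ c hT1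
  have hturn := abs_turn_lt α c (γ 0) (γ T)
  have hκc : (2 * e / Ω : ℂ) = κ := by
    have : 2 * e / Ω = κ := by rw [← hκΩ]; field_simp
    exact_mod_cast this
  have hexp : cexp (e * (T - (0 : ℝ)) * I) = w := by
    rw [hw, ← heT]; push_cast; ring_nf
  rw [hexp, sub_zero, hΩT, hκc, Real.cos_pi_div_two, Real.sin_pi_div_two, hamp, h0] at hA hB
  have hΩc : (Ω : ℂ) ≠ 0 := by exact_mod_cast hΩ0.ne'
  have hβc : (β : ℂ) ≠ 0 := by exact_mod_cast hβ.ne'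
  have hVΩ : V₀ / Ω = (conj w + I * κ) * relA α c p / conj (relB α c p) := by
    rw [hV₀]; field_simp
  rw [hVΩ] at hA hB
  have hA' : relA α c (γ T) = relA α c p := by
    rw [hA]
    push_cast
    field_simp
    linear_combination relA α c p * hww
  refine ⟨γ T, ⟨⟨0, T, hT0, γ, v, hgeo, hnull, h0, rfl⟩⟩, hA', ?_, ?_, by rw [hζ, hT]⟩
  · rw [hB]
    refine mul_right_cancel₀ hB0 ?_
    push_cast
    have e1 : (conj w + I * κ) * relA α c p / conj (relB α c p) * 1 * conj (relA α c p) =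
        (conj w + I * κ) * (1 + β) / conj (relB α c p) := by rw [← hAA]; ring
    rw [e1, mul_assoc w, add_mul, div_mul_cancel₀ _ hB0, mul_assoc ε, hBB]
    linear_combination (-w * κ * I) * hBB + (1 + β) * hww + hstar
  -- equal values of `relA` leave a multiple of `2π`, and both terms of the balance are small
  · have hd : delay κ (Real.pi / 2) = Real.pi / 2 - κ * (Real.pi / 4) := by
      simp [delay, windAngle]; ring
    rw [sub_zero, hΩT, hd, h0] at hang
    rw [h0] at hturn
    have hκ3 : κ < 2 := by nlinarith
    have hb1 := mul_pos hκ0 hpi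
    have hb2 := mul_lt_mul_of_pos_right hκ3 hpi
    obtain ⟨ht1, ht2⟩ := abs_lt.1 hturn
    have h1 := relA_polar α c (γ T)
    rw [hA'] at h1
    have h3 := h1.symm.trans (relA_polar α c p)
    have hn : (‖relA α c p‖ : ℂ) ≠ 0 := by
      exact_mod_cast (norm_pos_iff.2 (relA_ne_zero α c p)).ne'
    have h4 := mul_left_cancel₀ hn h3
    have h5 : cexp ((relAngle α c (γ T) - relAngle α c p : ℝ) * I) = 1 := by
      push_cast
      rw [sub_mul, Complex.exp_sub, h4, div_self (Complex.exp_ne_zero _)]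
    have h6 := congrArg re h5
    rw [exp_ofReal_mul_I_re, one_re] at h6
    have h7 := (Real.cos_eq_one_iff_of_lt_of_lt (by linarith) (by linarith)).1 h6
    linarith

end

section

open Complex ComplexConjugate

/-- There are base events at any prescribed positive distance from `p`: move along the ray from
the axis through `p`. -/
theorem exists_norm_relA_sq_eq {α : ℝ} (hα : 0 < α) (p : Event) {β : ℝ} (hβ : 0 < β) :
    ∃ c, ‖relA α c p‖ ^ 2 = 1 + β := by
  set r := ‖plane α p‖ with hr
  set R := stretch α p with hR
  set d := cexp (arg (plane α p) * I) with hd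
  have hdd : ‖d‖ = 1 := norm_exp_ofReal_mul_I _
  have hpd : plane α p = r * d := (norm_mul_exp_arg_mul_I _).symm
  have hR0 : 0 < R := stretch_pos α p
  have hr0 : 0 ≤ r := norm_nonneg _
  have hrR : R ^ 2 = 1 + r ^ 2 := by
    have := normSq_plane α p
    rw [normSq_eq_norm_sq] at this
    rw [hr, this]; ring
  obtain ⟨b, hb0, hb⟩ : ∃ b : ℝ, 0 < b ∧ b ^ 2 = β := ⟨√β, Real.sqrt_pos.2 hβ, Real.sq_sqrt hβ.le⟩
  obtain ⟨S, hS0, hS⟩ : ∃ S : ℝ, 0 < S ∧ S ^ 2 = 1 + β :=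
    ⟨√(1 + β), Real.sqrt_pos.2 (by positivity), Real.sq_sqrt (by positivity)⟩
  obtain ⟨z, hz⟩ : ∃ z : ℂ, z = (r * S + R * b : ℝ) * d := ⟨_, rfl⟩
  obtain ⟨c, hc⟩ : ∃ c : Event, c = ![0, z.re / α, z.im / α, 0] := ⟨_, rfl⟩
  have hcp : plane α c = z := by
    apply Complex.ext <;> simp [plane, hc] <;> field_simp
  have hcs : stretch α c = R * S + r * b := by
    have h1 := normSq_plane α c
    rw [hcp, hz, normSq_mul, normSq_ofReal, normSq_eq_norm_sq, hdd] at h1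
    have h2 := stretch_pos α c
    refine (pow_left_inj₀ h2.le (by positivity) two_ne_zero).1 ?_
    have h3 : stretch α c ^ 2 = 1 + (r * S + R * b) ^ 2 := by linarith
    rw [h3]
    linear_combination (b ^ 2 - S ^ 2) * hrR + hb - hS
  refine ⟨c, ?_⟩
  have h1 := norm_relB_sq α c p
  have h2 : relB α c p = (-b : ℝ) * d * phase α p := by
    rw [relB, ampA, ampB, hcp, hcs, hz, hpd, ← hR]
    have : (R : ℂ) ^ 2 = 1 + r ^ 2 := by exact_mod_cast hrR
    push_cast
    linear_combination (-(b * d * phase α p)) * this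
  rw [h2, norm_mul, norm_mul, norm_phase, hdd, norm_real, Real.norm_eq_abs, abs_neg, mul_one,
    mul_one, sq_abs, hb] at h1
  linarith

/-- The relative amplitudes and `relAngle` are coordinates. -/
theorem event_eq_of_rel {α : ℝ} (hα : 0 < α) {c p q : Event} (hA : relA α c p = relA α c q)
    (hB : relB α c p = relB α c q) (hang : relAngle α c p = relAngle α c q) (hζ : p 3 = q 3) :
    p = q := by
  have hc : plane α c * conj (plane α c) = (stretch α c : ℂ) ^ 2 - 1 := by
    rw [mul_conj, normSq_plane]; push_cast; ring
  have hA' : ampA α p = ampA α q := by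
    simp only [relA, relB] at hA hB
    linear_combination stretch α c * hA + conj (plane α c) * hB + (ampA α p - ampA α q) * hc
  have hB' : ampB α p = ampB α q := by
    simp only [relA, relB] at hA hB
    linear_combination plane α c * hA + stretch α c * hB + (ampB α p - ampB α q) * hc
  have hst : stretch α p = stretch α q := by
    have := congrArg norm hA'
    rwa [ampA, ampA, norm_mul, norm_mul, norm_phase, norm_phase, mul_one, mul_one, norm_real,
      norm_real, Real.norm_of_nonneg (stretch_pos α p).le,
      Real.norm_of_nonneg (stretch_pos α q).le] at this
  have hs0 : (stretch α q : ℂ) ≠ 0 := by exact_mod_cast (stretch_pos α q).ne'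
  have hph : phase α p = phase α q := by
    rw [ampA, ampA, hst] at hA'
    exact mul_left_cancel₀ hs0 hA'
  have hpl : plane α p = plane α q := by
    rw [ampB, ampB, hph] at hB'
    exact mul_right_cancel₀ (Complex.exp_ne_zero _) hB'
  have hrel : relPlane α c p = relPlane α c q := by rw [relPlane, relPlane, hst, hpl]
  rw [relAngle, relAngle, hrel] at hang
  have h0 := mul_left_cancel₀ (rate_pos hα).ne' (neg_injective (add_right_cancel hang))
  funext i
  fin_cases i
  · exact h0
  · exact mul_left_cancel₀ hα.ne' (congrArg re hpl)
  · exact mul_left_cancel₀ hα.ne' (congrArg im hpl)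
  · exact hζ

theorem exists_lightlikePath {α : ℝ} {A B : Event} (w : ℕ → Event) {n : ℕ} (hn : 0 < n)
    (hA : w 0 = A) (hB : w n = B)
    (h : ∀ i < n, Nonempty (NullGeodesicSegment α (w i) (w (i + 1)))) :
    ∃ path : LightlikePath α A B, path.numSegments = n :=
  ⟨{ numSegments := n
     numSegments_pos := hn
     vertex := fun i => w i
     source := hA
     target := hB
     segment := fun i => (h i i.2).some }, rfl⟩

/-- Eight octagon sides around a common centre, with alternating direction in `ζ`. -/
theorem exists_closed_lightlikePath {α : ℝ} (hα : 0 < α) (O : Event) :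
    ∃ path : LightlikePath α O O, path.numSegments = 8 := by
  obtain ⟨κ, β, hκ1, hκ2, hβ, hsin, hcos⟩ := exists_octagon_parameters
  obtain ⟨c, hc⟩ := exists_norm_relA_sq_eq hα O hβ
  obtain ⟨Z, hZ⟩ : ∃ Z : ℝ, κ ^ 2 * (1 + Z ^ 2) = 2 := by
    have hκ0 : 0 < κ ^ 2 := by positivity
    refine ⟨√(2 / κ ^ 2 - 1), ?_⟩
    rw [Real.sq_sqrt (by rw [sub_nonneg, one_le_div hκ0]; exact hκ2.le)]
    field_simp
    ring
  have hside : ∀ (i : ℕ) (p : {p : Event // ‖relA α c p‖ ^ 2 = 1 + β}),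
      ∃ q : {p : Event // ‖relA α c p‖ ^ 2 = 1 + β}, Nonempty (NullGeodesicSegment α p q) ∧
        relA α c q = relA α c p ∧ relB α c q = cexp ((Real.pi / 4 : ℝ) * I) * relB α c p ∧
        relAngle α c q = relAngle α c p ∧
        q.1 3 = p.1 3 + (-1) ^ i * Z * (Real.pi * κ / (4 * rate α)) := by
    intro i p
    obtain ⟨q, h1, h2, h3, h4, h5⟩ := exists_octagon_side hα hκ1 hκ2 hβ hsin hcos p.2
      (Z := (-1) ^ i * Z) (by
        rw [mul_pow, ← pow_mul, mul_comm i, pow_mul, neg_one_sq, one_pow, one_mul, hZ])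
    exact ⟨⟨q, by rw [h2, p.2]⟩, h1, h2, h3, h4, h5⟩
  choose next hseg hA hB hang hζ using hside
  obtain ⟨w, h0, hw⟩ : ∃ w : ℕ → {p : Event // ‖relA α c p‖ ^ 2 = 1 + β},
      (w 0).1 = O ∧ ∀ i, w (i + 1) = next i (w i) :=
    ⟨fun n => Nat.rec ⟨O, hc⟩ (fun i p => next i p) n, rfl, fun _ => rfl⟩
  have hε : cexp ((Real.pi / 4 : ℝ) * I) ^ 8 = 1 := by
    rw [← Complex.exp_nat_mul, ← Complex.exp_two_pi_mul_I]
    congr 1; push_cast; ring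
  have hAn : ∀ n, relA α c (w n).1 = relA α c O := fun n => by
    induction n with
    | zero => rw [h0]
    | succ n ih => rw [hw, hA, ih]
  have hBn : ∀ n, relB α c (w n).1 = cexp ((Real.pi / 4 : ℝ) * I) ^ n * relB α c O := fun n => by
    induction n with
    | zero => rw [h0, pow_zero, one_mul]
    | succ n ih => rw [hw, hB, ih, pow_succ]; ring
  have hangn : ∀ n, relAngle α c (w n).1 = relAngle α c O := fun n => by
    induction n with
    | zero => rw [h0]
    | succ n ih => rw [hw, hang, ih]
  have hζ8 : (w 8).1 3 = O 3 := by
    simp only [hw, hζ, h0]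
    ring
  have h8 : (w 8).1 = O := event_eq_of_rel hα (hAn 8)
    (by rw [hBn, hε, one_mul]) (hangn 8) hζ8
  exact exists_lightlikePath (fun n => (w n).1) (by norm_num) h0 h8
    fun i _ => by rw [hw]; exact hseg i (w i)

end

end Godel

end

theorem theorem2 (α : ℝ) (hα : 0 < α) (O : Godel.Event) :
    (∀ path : Godel.LightlikePath α O O, 8 ≤ path.numSegments) ∧
      ∃ path : Godel.LightlikePath α O O, path.numSegments = 8 := by
  exact ⟨fun path => path.eight_le_numSegments hα, Godel.exists_closed_lightlikePath hα O⟩
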